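/- Let $M$ be a paracompact (Hausdorff) $C^\infty$ manifold of finite dimension, and let $L$ be a $C^\infty$ vector $1$-form on $M$ (a field of endomorphisms $L_z:T_zM\to T_zM$) of constant rank $n\ge 1$, whose Nijenhuis tensor $N_L=\frac12[L,L]$ vanishes and such that $\operatorname{Im}(L_z)=\operatorname{Ker}(L_z)$ for all $z\in M$ (so $\dim M=2n$). Let $\Gamma$ be an $L$-connection on $M$, i.e. a $C^\infty$ vector $1$-form with $L\Gamma=L$ and $\Gamma L=-L$. Let $h=\frac12(I+\Gamma)$ be its horizontal projector, $H_z(M)=\operatorname{Im}(h_z)$ the horizontal space at $z$, and $R=-\frac12[h,h]$ its curvature. Here $[K,P]$ denotes the Frölicher–Nijenhuis bracket of vector $1$-forms, $$[K,P](X,Y)=[KX,PY]+[PX,KY]+(KP+PK)[X,Y]-K\big([PX,Y]+[X,PY]\big)-P\big([KX,Y]+[X,KY]\big)$$ for $C^\infty$ vector fields $X,Y$. Then the following assertions are equivalent: (a) the horizontal distribution $z\mapsto H_z(M)$ is completely integrable, i.e. around every point of $M$ there is a $C^\infty$ chart $(x^1,\dots,x^n,y^1,\dots,y^n)$ in whose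 domain the distribution is defined by the equations $dy^1=\dots=dy^n=0$; (b) the Nijenhuis tensor $N_\Gamma=\frac12[\Gamma,\Gamma]$ of $\Gamma$ vanishes; (c) the curvature $R$ of $\Gamma$ vanishes. -/

import Mathlib

open scoped Manifold ContDiff

noncomputable section

namespace LConn

variable {E : Type*} [NormedAddCommGroup E] [NormedSpace ℝ E]
  {M : Type*} [TopologicalSpace M] [ChartedSpace E M]

/-- A (rough) vector field on `M`: a section of the tangent bundle, of no assumed regularity. -/
abbrev VField (E : Type*) [NormedAddCommGroup E] [NormedSpace ℝ E]
    (M : Type*) [TopologicalSpace M] [ChartedSpace E M] : Type _ :=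
  ∀ x : M, TangentSpace 𝓘(ℝ, E) x

/-- A (rough) vector `1`-form on `M`: a field of endomorphisms of the tangent spaces. -/
abbrev VOneForm (E : Type*) [NormedAddCommGroup E] [NormedSpace ℝ E]
    (M : Type*) [TopologicalSpace M] [ChartedSpace E M] : Type _ :=
  ∀ x : M, TangentSpace 𝓘(ℝ, E) x →L[ℝ] TangentSpace 𝓘(ℝ, E) x

/-- The type in which vector `2`-forms live, seen as operations `(X, Y) ↦ B(X, Y)` on pairs of
vector fields. -/
abbrev VTwoForm (E : Type*) [NormedAddCommGroup E] [NormedSpace ℝ E]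
    (M : Type*) [TopologicalSpace M] [ChartedSpace E M] : Type _ :=
  VField E M → VField E M → VField E M

/-- The vector field `X` is of class `C^∞`. -/
def SmoothField [IsManifold 𝓘(ℝ, E) ∞ M] (X : VField E M) : Prop :=
  ContMDiff 𝓘(ℝ, E) 𝓘(ℝ, E).tangent ∞
    (fun x => (⟨x, X x⟩ : TangentBundle 𝓘(ℝ, E) M))

/-- The vector `1`-form `K` is of class `C^∞`, as a section of the bundle `End(TM)`. -/
def SmoothForm [IsManifold 𝓘(ℝ, E) ∞ M] (K : VOneForm E M) : Prop :=
  ContMDiff 𝓘(ℝ, E) (𝓘(ℝ, E).prod 𝓘(ℝ, E →L[ℝ] E)) ∞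
    (fun x => Bundle.TotalSpace.mk' (E →L[ℝ] E)
      (E := fun x : M => TangentSpace 𝓘(ℝ, E) x →L[ℝ] TangentSpace 𝓘(ℝ, E) x) x (K x))

/-- The vector field `K X`. -/
def app (K : VOneForm E M) (X : VField E M) : VField E M := fun x => K x (X x)

/-- The Lie bracket `[X, Y]` of vector fields. -/
def lie (X Y : VField E M) : VField E M := VectorField.mlieBracket 𝓘(ℝ, E) X Y

/-- The Frölicher–Nijenhuis bracket `[K, P]` of two vector `1`-forms, as a vector `2`-form:
`[K, P](X, Y) = [KX, PY] + [PX, KY] + (KP + PK)[X, Y]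
  - K([PX, Y] + [X, PY]) - P([KX, Y] + [X, KY])`. -/
def fnBracket (K P : VOneForm E M) : VTwoForm E M := fun X Y =>
  lie (app K X) (app P Y) + lie (app P X) (app K Y)
    + (app K (app P (lie X Y)) + app P (app K (lie X Y)))
    - app K (lie (app P X) Y + lie X (app P Y))
    - app P (lie (app K X) Y + lie X (app K Y))

/-- The Nijenhuis tensor `N_K = ½ [K, K]` of a vector `1`-form. -/
def nijenhuis (K : VOneForm E M) : VTwoForm E M := fun X Y =>
  (1 / 2 : ℝ) • fnBracket K K X Y

/-- A vector `2`-form vanishes when it vanishes on all pairs of `C^∞` vector fields. -/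
def Vanishes [IsManifold 𝓘(ℝ, E) ∞ M] (B : VTwoForm E M) : Prop :=
  ∀ X Y : VField E M, SmoothField X → SmoothField Y → B X Y = 0

/-- The structure carried by `M`: a `C^∞` vector `1`-form `L` of constant rank `n`, with vanishing
Nijenhuis tensor, and whose image coincides with its kernel at each point. -/
structure IsTangentStructure [IsManifold 𝓘(ℝ, E) ∞ M] (n : ℕ) (L : VOneForm E M) : Prop where
  smooth : SmoothForm L
  rank_eq : ∀ z, Module.finrank ℝ (L z).range = n
  nijenhuis_eq_zero : Vanishes (nijenhuis L)
  range_eq_ker : ∀ z, (L z).range = (L z).ker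

/-- `Γ` is an `L`-connection: a `C^∞` vector `1`-form with `L Γ = L` and `Γ L = -L`. -/
structure IsLConnection [IsManifold 𝓘(ℝ, E) ∞ M] (L Γ : VOneForm E M) : Prop where
  smooth : SmoothForm Γ
  comp_left : ∀ z, (L z).comp (Γ z) = L z
  comp_right : ∀ z, (Γ z).comp (L z) = -(L z)

/-- The horizontal projector `h = ½ (I + Γ)`. -/
def hproj (Γ : VOneForm E M) : VOneForm E M := fun z =>
  (1 / 2 : ℝ) • (ContinuousLinearMap.id ℝ (TangentSpace 𝓘(ℝ, E) z) + Γ z)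

/-- The horizontal space `H_z(M) = Im(h_z)`. -/
def horizontal (Γ : VOneForm E M) (z : M) : Submodule ℝ (TangentSpace 𝓘(ℝ, E) z) :=
  (hproj Γ z).range

/-- The curvature `R = -½ [h, h]`. -/
def curvature (Γ : VOneForm E M) : VTwoForm E M := fun X Y =>
  -((1 / 2 : ℝ) • fnBracket (hproj Γ) (hproj Γ) X Y)

/-- A distribution `D` is completely integrable: around each point there is a chart `φ` of the
`C^∞` structure which is flat for `D`, i.e. the differential of `φ` carries `D` to one fixed linear
subspace `W` of the model space (so that, after a linear change of coordinates adapted to `W`,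
`D` is spanned by the first coordinate vector fields, and is given by the vanishing of the
differentials of the remaining coordinates). -/
def CompletelyIntegrable [IsManifold 𝓘(ℝ, E) ∞ M]
    (D : ∀ z : M, Submodule ℝ (TangentSpace 𝓘(ℝ, E) z)) : Prop :=
  ∀ z : M, ∃ φ ∈ IsManifold.maximalAtlas 𝓘(ℝ, E) ∞ M, z ∈ φ.source ∧
    ∃ W : Submodule ℝ E, ∀ w ∈ φ.source, ∀ ξ : TangentSpace 𝓘(ℝ, E) w,
      ξ ∈ D w ↔ (mfderiv 𝓘(ℝ, E) 𝓘(ℝ, E) φ w ξ : E) ∈ W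

end LConn

end

/-! The conditions `L Γ = L` and `Γ L = -L` give `L h = L` and `h L = 0`. With `Im L = Ker L` this
makes `h` a projector with kernel `Ker L`, the vertical space. All brackets are read in charts,
where `½ [K, K]` becomes the tensor `nijenhuisAt`, built from `K` and its first derivative.

(b) ⇔ (c): the identity contributes nothing to the Nijenhuis tensor, so `[h, h] = ¼ [Γ, Γ]`
(`nijenhuisAt_half_id_add`).

(c) ⇒ (a): the tensor of `h` evaluated on horizontal vectors says that `Im h` is involutive
(`fderiv_apply_comm_of_nijenhuisAt_eq_zero`), and Frobenius gives a flat chart. Frobenius is proved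
here directly. Near a point, `Im h` is written as a graph over its value there, which yields a
commuting frame (`exists_frame_of_projector`). The curves tangent to this frame are solutions of an
equation in the Banach space `C([0, 1], E)`, and the inverse function theorem there gives their
smooth dependence on parameters (`exists_leafCurve`). Their endpoints form the inverse of a flat
chart (`exists_straightening`).

(a) ⇒ (c): in a flat chart `Im h` is a constant subspace, so only pairs of vertical vectors can
contribute to the tensor of `h`. On these, `N_L = 0` together with `L h = L` forces the contribution
to vanish (`nijenhuisAt_eq_zero_of_flat`). -/

noncomputable section
open Set Filter Topology

universe u

/-! ### Superposition operators and integration on spaces of continuous curves -/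

namespace ContinuousMap

variable {K : Type*} [TopologicalSpace K] [CompactSpace K]

/-- Pointwise evaluation of a continuous family of continuous linear maps at a continuous family of
vectors, as a continuous bilinear map. -/
def clmApply (K : Type*) [TopologicalSpace K] [CompactSpace K] (E F : Type*)
    [NormedAddCommGroup E] [NormedSpace ℝ E] [NormedAddCommGroup F] [NormedSpace ℝ F] :
    C(K, E →L[ℝ] F) →L[ℝ] C(K, E) →L[ℝ] C(K, F) :=
  LinearMap.mkContinuous₂
    (LinearMap.mk₂ ℝ (fun (A : C(K, E →L[ℝ] F)) (γ : C(K, E)) => 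
      (⟨fun t => A t (γ t), A.continuous.clm_apply γ.continuous⟩ : C(K, F)))
      (fun _ _ _ => by ext; simp) (fun _ _ _ => by ext; simp)
      (fun _ _ _ => by ext; simp) (fun _ _ _ => by ext; simp)) 1 (by
    intro A γ
    rw [one_mul, ContinuousMap.norm_le _ (by positivity)]
    intro t
    refine ((A t).le_opNorm _).trans ?_
    gcongr
    exacts [A.norm_coe_le_norm t, γ.norm_coe_le_norm t])

section

variable {E F : Type*} [NormedAddCommGroup E] [NormedSpace ℝ E] [NormedAddCommGroup F]
  [NormedSpace ℝ F]

@[simp]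
theorem clmApply_apply (A : C(K, E →L[ℝ] F)) (γ : C(K, E)) (t : K) :
    clmApply K E F A γ t = A t (γ t) := rfl

theorem _root_.HasFDerivAt.continuousMap_clmApply {X : Type*} [NormedAddCommGroup X]
    [NormedSpace ℝ X] {c : X → C(K, E →L[ℝ] F)} {c' : X →L[ℝ] C(K, E →L[ℝ] F)} {x : X}
    (hc : HasFDerivAt c c' x) :
    HasFDerivAt (fun y => clmApply K E F (c y)) ((clmApply K E F).comp c') x :=
  HasFDerivAt.comp (F := C(K, E →L[ℝ] F)) (G := C(K, E) →L[ℝ] C(K, F)) x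
    (clmApply K E F).hasFDerivAt hc

theorem _root_.ContDiff.continuousMap_clmApply {X : Type*} [NormedAddCommGroup X]
    [NormedSpace ℝ X] {n : ℕ∞ω} {c : X → C(K, E →L[ℝ] F)} (hc : ContDiff ℝ n c) :
    ContDiff ℝ n (fun y => clmApply K E F (c y)) :=
  ContDiff.comp (F := C(K, E →L[ℝ] F)) (G := C(K, E) →L[ℝ] C(K, F))
    (ContinuousLinearMap.contDiff (E := C(K, E →L[ℝ] F)) (F := C(K, E) →L[ℝ] C(K, F)) _) hc

/-- The superposition operator of a `C^1` map is differentiable, and its derivative is the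
superposition operator of the derivative. -/
theorem hasFDerivAt_comp_left {f : C(E, F)} {f' : C(E, E →L[ℝ] F)}
    (hf : ∀ x, HasFDerivAt f (f' x) x) (γ : C(K, E)) :
    HasFDerivAt (fun η : C(K, E) => f.comp η) (clmApply K E F (f'.comp γ)) γ := by
  rw [hasFDerivAt_iff_isLittleO_nhds_zero, Asymptotics.isLittleO_iff]
  intro ε hε
  have hc : ContinuousAt (fun η : C(K, E) => f'.comp η) γ :=
    (ContinuousMap.continuous_postcomp f').continuousAt
  obtain ⟨δ, hδ, H⟩ :=
    (Metric.continuousAt_iff (α := C(K, E)) (β := C(K, E →L[ℝ] F))).1 hc ε hε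
  filter_upwards [Metric.ball_mem_nhds (0 : C(K, E)) hδ] with h hh
  rw [ContinuousMap.norm_le _ (by positivity)]
  intro t
  -- Each point of the segment is the value at `t` of a curve `γ + s • h`, which is `δ`-close to `γ`
  -- in sup norm. One `δ` thus serves every `t` in the mean value inequality.
  have key : ∀ x ∈ segment ℝ (γ t) (γ t + h t), ‖f' x - f' (γ t)‖ ≤ ε := by
    intro x hx
    rw [segment_eq_image'] at hx
    obtain ⟨s, hs, rfl⟩ := hx
    have h1 : dist (γ + s • h) γ < δ := by
      rw [dist_eq_norm, add_sub_cancel_left, norm_smul, Real.norm_eq_abs, abs_of_nonneg hs.1]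
      have : ‖h‖ < δ := by simpa using hh
      nlinarith [norm_nonneg h, hs.2]
    have h2 := (ContinuousMap.dist_apply_le_dist t).trans (H h1).le
    rw [dist_eq_norm] at h2
    simpa using h2
  have := (convex_segment (𝕜 := ℝ) (γ t) (γ t + h t)).norm_image_sub_le_of_norm_hasFDerivWithin_le'
    (fun x _ => (hf x).hasFDerivWithinAt) key (left_mem_segment ℝ _ _) (right_mem_segment ℝ _ _)
  simp only [add_sub_cancel_left] at this
  refine le_trans (by simpa using this) ?_
  gcongr
  exact h.norm_coe_le_norm t

end

/-- The superposition operator of a smooth map is smooth. -/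
theorem contDiff_comp_left {E F : Type u} [NormedAddCommGroup E] [NormedSpace ℝ E]
    [NormedAddCommGroup F] [NormedSpace ℝ F] (f : C(E, F)) (hf : ContDiff ℝ ∞ f) :
    ContDiff ℝ ∞ (fun η : C(K, E) => f.comp η) := by
  rw [contDiff_infty]
  intro n
  -- The derivative is governed by the superposition operator of `fderiv ℝ f`, whose target is `E
  -- →L[ℝ] F`. The target must therefore vary in the induction, which is why `E` and `F` share a
  -- universe.
  induction n generalizing F with
  | zero =>
    exact contDiff_zero.2 (ContinuousMap.continuous_postcomp f)
  | succ n ih =>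
    have hf1 : ContDiff ℝ ∞ (fderiv ℝ f) := hf.fderiv_right (by simp)
    let f' : C(E, E →L[ℝ] F) := ⟨fderiv ℝ f, hf1.continuous⟩
    have hd : ∀ γ : C(K, E), HasFDerivAt (fun η : C(K, E) => f.comp η)
        (clmApply K E F (f'.comp γ)) γ :=
      hasFDerivAt_comp_left fun x => (hf.differentiable (by simp) x).hasFDerivAt
    have h : fderiv ℝ (fun η : C(K, E) => f.comp η) = fun γ => clmApply K E F (f'.comp γ) :=
      funext fun γ => (hd γ).fderiv
    rw [show ((n + 1 : ℕ) : ℕ∞ω) = (n : ℕ∞ω) + 1 by norm_cast, contDiff_succ_iff_fderiv]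
    refine ⟨fun γ => (hd γ).differentiableAt, by simp, ?_⟩
    rw [h]
    exact (clmApply K E F).contDiff.comp (ih f' hf1)

end ContinuousMap

namespace ContinuousMap

theorem continuous_IccExtend {E : Type*} [TopologicalSpace E] (γ : C(unitInterval, E)) :
    Continuous (Set.IccExtend (zero_le_one' ℝ) γ) :=
  γ.continuous.Icc_extend'

variable {E : Type*} [NormedAddCommGroup E] [NormedSpace ℝ E]

/-- The primitive vanishing at `0` of a continuous function on the unit interval, extended to the
real line. -/
def primitive (γ : C(unitInterval, E)) (t : ℝ) : E :=
  ∫ s in (0 : ℝ)..t, Set.IccExtend (zero_le_one' ℝ) γ s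

theorem hasDerivAt_primitive [CompleteSpace E] (γ : C(unitInterval, E)) (t : ℝ) :
    HasDerivAt γ.primitive (Set.IccExtend (zero_le_one' ℝ) γ t) t :=
  (continuous_IccExtend γ).integral_hasStrictDerivAt 0 t |>.hasDerivAt

variable (E) in
/-- Integration from the origin, as a continuous linear operator on `C([0, 1], E)`. -/
def integrate [CompleteSpace E] : C(unitInterval, E) →L[ℝ] C(unitInterval, E) :=
  LinearMap.mkContinuous
    { toFun := fun γ => (⟨fun t => γ.primitive t,
        (continuous_iff_continuousAt.2 fun t => (γ.hasDerivAt_primitive t).continuousAt).comp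
          continuous_subtype_val⟩ : C(unitInterval, E))
      map_add' := fun γ η => by
        ext t
        exact intervalIntegral.integral_add ((continuous_IccExtend γ).intervalIntegrable _ _)
          ((continuous_IccExtend η).intervalIntegrable _ _)
      map_smul' := fun c γ => by
        ext t
        exact intervalIntegral.integral_smul c _ } 1 (by
    intro γ
    rw [one_mul, ContinuousMap.norm_le _ (by positivity)]
    intro t
    have h : ‖γ.primitive t‖ ≤ ‖γ‖ * |(t : ℝ) - 0| :=
      intervalIntegral.norm_integral_le_of_norm_le_const fun s _ => γ.norm_coe_le_norm _
    refine h.trans (mul_le_of_le_one_right (norm_nonneg γ) ?_)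
    rw [sub_zero, abs_of_nonneg t.2.1]
    exact t.2.2)

@[simp]
theorem integrate_apply [CompleteSpace E] (γ : C(unitInterval, E)) (t : unitInterval) :
    integrate E γ t = γ.primitive t := rfl

/-- A continuous function on `[0, 1]` which extends to a function vanishing at `0` with derivative
`γ` is the primitive of `γ`. -/
theorem eq_integrate_of_hasDerivAt [CompleteSpace E] {f : ℝ → E} {γ : C(unitInterval, E)}
    (h0 : f 0 = 0) (hf : ∀ t : unitInterval, HasDerivAt f (γ t) t) (t : unitInterval) :
    f t = integrate E γ t := by
  rw [integrate_apply, primitive, intervalIntegral.integral_eq_sub_of_hasDerivAt (f := f)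
    (fun s hs => ?_) ((continuous_IccExtend γ).intervalIntegrable _ _), h0, sub_zero]
  rw [uIcc_of_le t.2.1] at hs
  have hs' : s ∈ Icc (0 : ℝ) 1 := ⟨hs.1, hs.2.trans t.2.2⟩
  rw [Set.IccExtend_of_mem _ _ hs']
  exact hf ⟨s, hs'⟩

end ContinuousMap

namespace ContinuousMap

/-- Constant maps, as a continuous linear map. -/
def constCLM (K E : Type*) [TopologicalSpace K] [CompactSpace K] [NormedAddCommGroup E]
    [NormedSpace ℝ E] : E →L[ℝ] C(K, E) :=
  LinearMap.mkContinuous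
    { toFun := fun v => ContinuousMap.const K v
      map_add' := fun _ _ => rfl
      map_smul' := fun _ _ => rfl } 1 (fun v => by
    rw [one_mul, ContinuousMap.norm_le _ (by positivity)]
    exact fun _ => le_rfl)

@[simp]
theorem constCLM_apply {K E : Type*} [TopologicalSpace K] [CompactSpace K] [NormedAddCommGroup E]
    [NormedSpace ℝ E] (v : E) (t : K) : constCLM K E v t = v := rfl

end ContinuousMap

/-! ### Frobenius theorem: the equation of curves in the leaves -/

namespace Frobenius

open ContinuousMap unitInterval

variable {E : Type u} [NormedAddCommGroup E] [NormedSpace ℝ E] [CompleteSpace E]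

/-- The equation of the curves in the leaves: `leafDefect S P e₀ (u, γ) = 0` says that `γ` is the
solution on `[0, 1]` of `γ' = S(γ) (P (u - e₀))` which starts from `u - P (u - e₀)`. -/
def leafDefect (S : C(E, E →L[ℝ] E)) (P : E →L[ℝ] E) (e₀ : E) (p : E × C(I, E)) : C(I, E) :=
  p.2 - constCLM I E (p.1 - P (p.1 - e₀)) -
    integrate E (clmApply I E E (S.comp p.2) (constCLM I E (P (p.1 - e₀))))

/-- The derivative of `leafDefect`. -/
def leafDefectDeriv (S : C(E, E →L[ℝ] E)) (S' : C(E, E →L[ℝ] E →L[ℝ] E)) (P : E →L[ℝ] E) (e₀ : E)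
    (p : E × C(I, E)) : E × C(I, E) →L[ℝ] C(I, E) :=
  ContinuousLinearMap.snd ℝ E C(I, E) -
    (constCLM I E).comp ((ContinuousLinearMap.id ℝ E - P).comp
      (ContinuousLinearMap.fst ℝ E C(I, E)))
    - (integrate E).comp
      ((clmApply I E E (S.comp p.2)).comp
          ((constCLM I E).comp (P.comp (ContinuousLinearMap.fst ℝ E C(I, E))))
        + ((clmApply I E E).comp ((clmApply I E (E →L[ℝ] E) (S'.comp p.2)).comp
          (ContinuousLinearMap.snd ℝ E C(I, E)))).flip (constCLM I E (P (p.1 - e₀))))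

theorem leafDefectDeriv_apply (S : C(E, E →L[ℝ] E)) (S' : C(E, E →L[ℝ] E →L[ℝ] E))
    (P : E →L[ℝ] E) (e₀ : E) (p q : E × C(I, E)) :
    leafDefectDeriv S S' P e₀ p q = q.2 - constCLM I E (q.1 - P q.1) -
      integrate E (clmApply I E E (S.comp p.2) (constCLM I E (P q.1)) +
        clmApply I E E (clmApply I E (E →L[ℝ] E) (S'.comp p.2) q.2)
          (constCLM I E (P (p.1 - e₀)))) := rfl

theorem hasFDerivAt_leafDefect {S : C(E, E →L[ℝ] E)} {S' : C(E, E →L[ℝ] E →L[ℝ] E)}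
    (hS' : ∀ e, HasFDerivAt S (S' e) e) (P : E →L[ℝ] E) (e₀ : E) (p : E × C(I, E)) :
    HasFDerivAt (leafDefect S P e₀) (leafDefectDeriv S S' P e₀ p) p := by
  have hP : HasFDerivAt (fun q : E × C(I, E) => P (q.1 - e₀))
      (P.comp (ContinuousLinearMap.fst ℝ E C(I, E))) p :=
    P.hasFDerivAt.comp p (hasFDerivAt_fst.sub_const e₀)
  have hs : HasFDerivAt (fun q : E × C(I, E) => S.comp q.2)
      ((clmApply I E (E →L[ℝ] E) (S'.comp p.2)).comp (ContinuousLinearMap.snd ℝ E C(I, E))) p :=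
    (hasFDerivAt_comp_left hS' p.2).comp p hasFDerivAt_snd
  have hc : HasFDerivAt (fun q : E × C(I, E) => clmApply I E E (S.comp q.2))
      ((clmApply I E E).comp ((clmApply I E (E →L[ℝ] E) (S'.comp p.2)).comp
          (ContinuousLinearMap.snd ℝ E C(I, E)))) p :=
    HasFDerivAt.continuousMap_clmApply hs
  have h1 : HasFDerivAt (fun q : E × C(I, E) => constCLM I E (q.1 - P (q.1 - e₀)))
      ((constCLM I E).comp
        ((ContinuousLinearMap.id ℝ E - P).comp (ContinuousLinearMap.fst ℝ E C(I, E)))) p :=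
    (constCLM I E).hasFDerivAt.comp p (hasFDerivAt_fst.sub hP)
  exact (hasFDerivAt_snd.sub h1).sub ((integrate E).hasFDerivAt.comp p
    (hc.clm_apply ((constCLM I E).hasFDerivAt.comp p hP)))

theorem contDiff_leafDefect {S : C(E, E →L[ℝ] E)} (hS : ContDiff ℝ ∞ S) (P : E →L[ℝ] E) (e₀ : E) :
    ContDiff ℝ ∞ (leafDefect S P e₀) := by
  have hP : ContDiff ℝ ∞ (fun q : E × C(I, E) => P (q.1 - e₀)) :=
    P.contDiff.comp (contDiff_fst.sub contDiff_const)
  have hs : ContDiff ℝ ∞ (fun q : E × C(I, E) => S.comp q.2) :=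
    (contDiff_comp_left S hS).comp contDiff_snd
  have hc : ContDiff ℝ ∞ (fun q : E × C(I, E) => clmApply I E E (S.comp q.2)) :=
    ContDiff.continuousMap_clmApply hs
  exact (contDiff_snd.sub ((constCLM I E).contDiff.comp (contDiff_fst.sub hP))).sub
    ((integrate E).contDiff.comp (hc.clm_apply ((constCLM I E).contDiff.comp hP)))

/-- At `u = e₀` the velocity parameter `P (u - e₀)` is zero, so the term in `S'` drops out and the
curve enters the linearised equation only through the identity. -/
theorem leafDefectDeriv_const {S : C(E, E →L[ℝ] E)} {S' : C(E, E →L[ℝ] E →L[ℝ] E)}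
    {P : E →L[ℝ] E} {e₀ : E} (hP : ∀ x, P (P x) = P x) (h0 : S e₀ = P) (q : E × C(I, E)) :
    leafDefectDeriv S S' P e₀ (e₀, constCLM I E e₀) q =
      q.2 - constCLM I E (q.1 - P q.1) - integrate E (constCLM I E (P q.1)) := by
  rw [leafDefectDeriv_apply]
  congr 2
  ext t
  simp [h0, hP]

/-- Smooth dependence of the curves in the leaves on their parameter. -/
theorem exists_leafCurve {S : C(E, E →L[ℝ] E)} {S' : C(E, E →L[ℝ] E →L[ℝ] E)}
    (hS : ContDiff ℝ ∞ S) (hS' : ∀ e, HasFDerivAt S (S' e) e)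
    {P : E →L[ℝ] E} {e₀ : E} (hP : ∀ x, P (P x) = P x) (h0 : S e₀ = P) :
    ∃ g : E → C(I, E), g e₀ = constCLM I E e₀ ∧ ∀ᶠ u in 𝓝 e₀, ContDiffAt ℝ ∞ g u ∧
      leafDefect S P e₀ (u, g u) = 0 ∧
      ∀ η, leafDefectDeriv S S' P e₀ (u, g u) (0, η) = 0 → η = 0 := by
  let H : E × C(I, E) → E × C(I, E) := fun p => (p.1, leafDefect S P e₀ p)
  let H' : E × C(I, E) → E × C(I, E) →L[ℝ] E × C(I, E) := fun p =>
    (ContinuousLinearMap.fst ℝ E C(I, E)).prod (leafDefectDeriv S S' P e₀ p)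
  have hH' : ∀ p, HasFDerivAt H (H' p) p := fun p =>
    hasFDerivAt_fst.prodMk (hasFDerivAt_leafDefect hS' P e₀ p)
  have hH : ContDiff ℝ ∞ H := contDiff_fst.prodMk (contDiff_leafDefect hS P e₀)
  let p₀ : E × C(I, E) := (e₀, constCLM I E e₀)
  have hHp₀ : H p₀ = (e₀, 0) := by
    refine Prod.ext rfl ?_
    have : constCLM I E (0 : E) = 0 := map_zero _
    simp [H, p₀, leafDefect]
  -- The derivative of `H` at the base point is triangular with identities on the diagonal, hence
  -- invertible.
  let T : (E × C(I, E)) ≃L[ℝ] E × C(I, E) :=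
    (ContinuousLinearEquiv.refl ℝ E).skewProd (ContinuousLinearEquiv.refl ℝ C(I, E))
      (-((constCLM I E).comp (ContinuousLinearMap.id ℝ E - P) +
        (integrate E).comp ((constCLM I E).comp P)))
  have hT : H' p₀ = (T : E × C(I, E) →L[ℝ] E × C(I, E)) := by
    refine ContinuousLinearMap.ext fun q => Prod.ext rfl ?_
    change leafDefectDeriv S S' P e₀ (e₀, constCLM I E e₀) q = q.2 + _
    rw [leafDefectDeriv_const hP h0]
    change _ = q.2 + -(constCLM I E (q.1 - P q.1) + integrate E (constCLM I E (P q.1)))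
    abel
  let Θ := hH.contDiffAt.toOpenPartialHomeomorph H (hT ▸ hH' p₀) (by simp)
  have hp₀ : p₀ ∈ Θ.source := hH.contDiffAt.mem_toOpenPartialHomeomorph_source _ _
  have hΘ : ∀ p, Θ p = H p := fun p => rfl
  have hΘp₀ : Θ.symm (e₀, 0) = p₀ := by rw [← hHp₀, ← hΘ, Θ.left_inv hp₀]
  have hq₀ : ((e₀, 0) : E × C(I, E)) ∈ Θ.target := by rw [← hHp₀, ← hΘ]; exact Θ.map_source hp₀
  have hincl : Continuous fun u : E => ((u, 0) : E × C(I, E)) := by fun_prop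
  have hcont : ContinuousAt (fun u : E => Θ.symm (u, 0)) e₀ :=
    ContinuousAt.comp (g := Θ.symm) (Θ.continuousAt_symm hq₀) hincl.continuousAt
  have hH'c : Continuous H' := by
    rw [show H' = fderiv ℝ H from funext fun p => (hH' p).fderiv.symm]
    exact hH.continuous_fderiv (by simp)
  -- Invertibility is an open condition. At nearby points it gives both smoothness of the inverse
  -- and uniqueness for the linearised equation.
  have hinv : ∀ᶠ u in 𝓝 e₀, H' (Θ.symm (u, 0)) ∈
      range ((↑) : ((E × C(I, E)) ≃L[ℝ] E × C(I, E)) → E × C(I, E) →L[ℝ] E × C(I, E)) := by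
    refine (hH'c.continuousAt.comp hcont).eventually_mem (ContinuousLinearEquiv.isOpen.mem_nhds ?_)
    simp only [Function.comp_apply, hΘp₀, hT, mem_range_self]
  refine ⟨fun u => (Θ.symm (u, 0)).2, by simp only [hΘp₀, p₀], ?_⟩
  filter_upwards [hinv, hincl.continuousAt.eventually_mem (Θ.open_target.mem_nhds hq₀)]
    with u ⟨A, hA⟩ hu
  have hsymm : H (Θ.symm (u, 0)) = (u, 0) := Θ.right_inv hu
  have hfst : (u, (Θ.symm (u, 0)).2) = Θ.symm (u, 0) := Prod.ext (congrArg Prod.fst hsymm).symm rfl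
  refine ⟨?_, ?_, ?_⟩
  · exact contDiffAt_snd.comp u ((Θ.contDiffAt_symm hu (f₀' := A) (hA ▸ hH' _)
      hH.contDiffAt).comp u (contDiffAt_id.prodMk contDiffAt_const))
  · rw [hfst]
    exact congrArg Prod.snd hsymm
  · intro η hη
    rw [hfst] at hη
    have : A (0, η) = 0 := by
      rw [← ContinuousLinearEquiv.coe_coe, hA]
      exact Prod.ext rfl hη
    exact congrArg Prod.snd ((map_eq_zero_iff A A.injective).1 this)

end Frobenius

/-! ### Frobenius theorem: straightening a commuting frame -/

namespace Frobenius

open ContinuousMap unitInterval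

variable {E : Type u} [NormedAddCommGroup E] [NormedSpace ℝ E] [CompleteSpace E]

theorem eq_of_leafDefect_eq_zero {S : C(E, E →L[ℝ] E)} {P : E →L[ℝ] E} {e₀ u : E}
    {γ : C(I, E)} (h : leafDefect S P e₀ (u, γ) = 0) (t : I) :
    γ t = u - P (u - e₀) +
      primitive (clmApply I E E (S.comp γ) (constCLM I E (P (u - e₀)))) t := by
  have := DFunLike.congr_fun h t
  simp only [leafDefect, coe_sub, Pi.sub_apply, constCLM_apply, integrate_apply, coe_zero,
    Pi.zero_apply] at this
  rw [← sub_eq_zero, ← this]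
  abel

/-- Under the integrability condition, `t ↦ t S(γ t) ξ` solves the linearised equation. -/
theorem leafDefectDeriv_smul_eq_zero {S : C(E, E →L[ℝ] E)} {S' : C(E, E →L[ℝ] E →L[ℝ] E)}
    (hS' : ∀ e, HasFDerivAt S (S' e) e) {P : E →L[ℝ] E} {e₀ u : E} {γ K : C(I, E)}
    (hP : ∀ x, P (P x) = P x) (hSP : ∀ e x, S e (P x) = S e x)
    (h : leafDefect S P e₀ (u, γ) = 0)
    (hsymm : ∀ t x y, S' (γ t) (S (γ t) x) y = S' (γ t) (S (γ t) y) x)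
    (ξ : E) (hK : ∀ t : I, K t = (t : ℝ) • S (γ t) ξ) :
    leafDefectDeriv S S' P e₀ (u, γ) (P ξ, K) = 0 := by
  have hγ := eq_of_leafDefect_eq_zero h
  set c : C(I, E) := clmApply I E E (S.comp γ) (constCLM I E (P (u - e₀))) with hc
  -- `G` extends `γ` to the real line, so that two-sided derivatives exist at the endpoints of `[0,
  -- 1]` as well.
  let G : ℝ → E := fun t => u - P (u - e₀) + c.primitive t
  have hG : ∀ t : I, HasDerivAt G (S (γ t) (P (u - e₀))) t := by
    intro t
    have := (c.hasDerivAt_primitive t).const_add (u - P (u - e₀))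
    rwa [Set.IccExtend_of_mem _ _ t.2] at this
  have hGγ : ∀ t : I, G t = γ t := fun t => (hγ t).symm
  rw [leafDefectDeriv_apply, sub_eq_zero]
  ext t
  rw [coe_sub, Pi.sub_apply, constCLM_apply, hP, sub_self, sub_zero, hK, ← hGγ t]
  refine eq_integrate_of_hasDerivAt (f := fun s => s • S (G s) ξ) (by simp) (fun s => ?_) t
  have h1 : HasDerivAt (fun s => S (G s)) (S' (γ s) (S (γ s) (P (u - e₀)))) (s : ℝ) :=
    HasFDerivAt.comp_hasDerivAt (s : ℝ) (by rw [hGγ]; exact hS' _) (hG s)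
  convert (hasDerivAt_id (s : ℝ)).smul (h1.clm_apply (hasDerivAt_const (s : ℝ) ξ)) using 1
  · rfl
  -- The symmetry exchanges `P (u - e₀)` and `ξ`, turning the derivative of `S (G s) ξ` along the
  -- curve into the `S'` term of the linearised equation.
  · rw [hsymm s _ ξ]
    rw [coe_add, Pi.add_apply, clmApply_apply, clmApply_apply, clmApply_apply, hGγ]
    simp only [comp_apply, constCLM_apply, hSP, hK, map_smul, _root_.smul_apply, map_zero, add_zero,
      one_smul, id]
    rw [add_comm]

/-- **Frobenius theorem**, local form, for the distribution spanned by the fields `e ↦ S e x`. -/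
theorem exists_straightening {S : C(E, E →L[ℝ] E)} (hS : ContDiff ℝ ∞ S)
    {P : E →L[ℝ] E} {e₀ : E} (hP : ∀ x, P (P x) = P x) (h0 : S e₀ = P)
    (hSP : ∀ e x, S e (P x) = S e x)
    (hsymm : ∀ᶠ e in 𝓝 e₀, ∀ x y, fderiv ℝ S e (S e x) y = fderiv ℝ S e (S e y) x) :
    ∃ Φ : OpenPartialHomeomorph E E, e₀ ∈ Φ.source ∧ Φ e₀ = e₀ ∧ ContDiffOn ℝ ∞ Φ Φ.source ∧
      ContDiffOn ℝ ∞ Φ.symm Φ.target ∧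
      ∀ u ∈ Φ.source, ∀ ξ, fderiv ℝ Φ u (P ξ) = S (Φ u) ξ := by
  let S' : C(E, E →L[ℝ] E →L[ℝ] E) := ⟨fderiv ℝ S, hS.continuous_fderiv (by simp)⟩
  have hS' : ∀ e, HasFDerivAt S (S' e) e := fun e =>
    (hS.differentiable (by simp) e).hasFDerivAt
  obtain ⟨g, hg0, hg⟩ := exists_leafCurve hS hS' hP h0
  let Φ₀ : E → E := fun u => g u 1
  have hgc : ContinuousAt g e₀ := hg.self_of_nhds.1.continuousAt
  have hder : ∀ u, ContDiffAt ℝ ∞ g u → HasFDerivAt Φ₀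
      ((evalCLM ℝ (1 : I)).comp (fderiv ℝ g u)) u := fun u hu =>
    HasFDerivAt.comp (g := fun γ : C(I, E) => γ 1) u
      (ContinuousLinearMap.hasFDerivAt (E := C(I, E)) (evalCLM ℝ (1 : I)))
      (hu.differentiableAt (by simp)).hasFDerivAt
  -- Obtained by differentiating the identity `leafDefect S P e₀ (v, g v) = 0` in `v`.
  have hlin : ∀ᶠ u in 𝓝 e₀, ∀ η, leafDefectDeriv S S' P e₀ (u, g u) (η, fderiv ℝ g u η) = 0 := by
    filter_upwards [hg.eventually_nhds] with u hu η
    have h1 : HasFDerivAt (fun v => leafDefect S P e₀ (v, g v))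
        ((leafDefectDeriv S S' P e₀ (u, g u)).comp
          ((ContinuousLinearMap.id ℝ E).prod (fderiv ℝ g u))) u :=
      HasFDerivAt.comp (f := fun v => (v, g v)) u (hasFDerivAt_leafDefect hS' P e₀ (u, g u))
        ((hasFDerivAt_id u).prodMk (hu.self_of_nhds.1.differentiableAt (by simp)).hasFDerivAt)
    have h2 : HasFDerivAt (fun v => leafDefect S P e₀ (v, g v)) (0 : E →L[ℝ] C(I, E)) u :=
      (hasFDerivAt_const (0 : C(I, E)) u).congr_of_eventuallyEq (hu.mono fun v hv => hv.2.1)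
    exact DFunLike.congr_fun (h1.unique h2) η
  -- At `e₀` the linearised curve in direction `η` is `η - P η + t • P η`, which equals `η` at `t =
  -- 1`.
  have hΦ₀id : fderiv ℝ Φ₀ e₀ = ((ContinuousLinearEquiv.refl ℝ E : E ≃L[ℝ] E) : E →L[ℝ] E) := by
    rw [(hder e₀ hg.self_of_nhds.1).fderiv]
    ext η
    have h1 := hlin.self_of_nhds η
    rw [hg0, leafDefectDeriv_const hP h0] at h1
    have h2 := eq_integrate_of_hasDerivAt (f := fun s : ℝ => s • P η) (γ := constCLM I E (P η))
      (by simp) (fun s => by simpa using (hasDerivAt_id (s : ℝ)).smul_const (P η)) 1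
    have h3 := DFunLike.congr_fun h1 1
    simp only [coe_sub, Pi.sub_apply, constCLM_apply, ← h2, coe_zero, Pi.zero_apply] at h3
    change fderiv ℝ g e₀ η 1 = η
    rw [← sub_eq_zero, ← h3, Icc.coe_one, one_smul]
    abel
  have hnear : ∀ᶠ u in 𝓝 e₀, ∀ t : I, ∀ x y,
      S' (g u t) (S (g u t) x) y = S' (g u t) (S (g u t) y) x := by
    obtain ⟨r, hr, H⟩ := Metric.eventually_nhds_iff.1 hsymm
    filter_upwards [Metric.continuousAt_iff'.1 hgc r hr] with u hu t
    refine H ((dist_apply_le_dist (f := g u) (g := constCLM I E e₀) t).trans_lt ?_)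
    rwa [← hg0]
  -- The derivative of `g` along `P ξ` and the curve `t • S (g u t) ξ` solve the same linearised
  -- equation, so they coincide. Evaluation at `t = 1` gives the claim.
  have hspan : ∀ᶠ u in 𝓝 e₀, ∀ ξ, fderiv ℝ Φ₀ u (P ξ) = S (Φ₀ u) ξ := by
    filter_upwards [hg, hlin, hnear] with u hu hl hn ξ
    let K : C(I, E) := ⟨fun t => (t : ℝ) • S (g u t) ξ, by fun_prop⟩
    have h1 := leafDefectDeriv_smul_eq_zero hS' hP hSP hu.2.1 hn ξ (K := K) fun _ => rfl
    have h2 := hl (P ξ)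
    have h3 : fderiv ℝ g u (P ξ) - K = 0 := by
      refine hu.2.2 _ ?_
      rw [show ((0 : E), fderiv ℝ g u (P ξ) - K) = (P ξ, fderiv ℝ g u (P ξ)) - (P ξ, K) by simp,
        map_sub, h1, h2, sub_zero]
    rw [(hder u hu.1).fderiv]
    change fderiv ℝ g u (P ξ) 1 = _
    rw [sub_eq_zero.1 h3]
    simp [K, Φ₀]
  have hsmooth : ∀ᶠ u in 𝓝 e₀, ContDiffAt ℝ ∞ Φ₀ u := hg.mono fun u hu =>
    ContDiffAt.comp (g := fun γ : C(I, E) => γ 1) u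
      (ContinuousLinearMap.contDiff (E := C(I, E)) (evalCLM ℝ (1 : I))).contDiffAt hu.1
  have hinv : ∀ᶠ u in 𝓝 e₀, fderiv ℝ Φ₀ u ∈ range ((↑) : (E ≃L[ℝ] E) → E →L[ℝ] E) := by
    have hc : ContinuousAt (fderiv ℝ Φ₀) e₀ :=
      (hsmooth.self_of_nhds.fderiv_right (m := 0) (by simp)).continuousAt
    exact hc.eventually_mem (ContinuousLinearEquiv.isOpen.mem_nhds
      (by rw [hΦ₀id]; exact mem_range_self _))
  obtain ⟨s, hs, hso, hes⟩ := eventually_nhds_iff.1 (hsmooth.and (hinv.and hspan))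
  have hΦ' : HasFDerivAt Φ₀ ((ContinuousLinearEquiv.refl ℝ E : E ≃L[ℝ] E) : E →L[ℝ] E) e₀ :=
    hΦ₀id ▸ (hsmooth.self_of_nhds.differentiableAt (by simp)).hasFDerivAt
  let Φ := (hsmooth.self_of_nhds.toOpenPartialHomeomorph Φ₀ hΦ' (by simp)).restrOpen s hso
  have hΦs : ∀ u ∈ Φ.source, u ∈ s := fun u hu => hu.2
  have hΦ : (Φ : E → E) = Φ₀ := rfl
  refine ⟨Φ, ⟨hsmooth.self_of_nhds.mem_toOpenPartialHomeomorph_source hΦ' _, hes⟩, ?_, ?_, ?_, ?_⟩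
  · rw [hΦ]
    simp [Φ₀, hg0]
  · exact fun u hu => (hs u (hΦs u hu)).1.contDiffWithinAt
  · intro v hv
    obtain ⟨h1, ⟨A, hA⟩, -⟩ := hs _ (hΦs _ (Φ.map_target hv))
    exact (Φ.contDiffAt_symm hv (f₀' := A)
      (hA ▸ (h1.differentiableAt (by simp)).hasFDerivAt) h1).contDiffWithinAt
  · exact fun u hu => (hs u (hΦs u hu)).2.2

end Frobenius

/-! ### Frobenius theorem: from an involutive field of projectors to a flat chart -/

namespace Frobenius

/-- Here `(Q - P) d = d` with `‖Q - P‖ < 1`. For nearby projectors, an identity between vectors of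
`Im Q` can therefore be checked after applying `P`. -/
theorem eq_zero_of_apply_eq_self_of_norm_sub_lt_one {E : Type*} [NormedAddCommGroup E]
    [NormedSpace ℝ E] {P Q : E →L[ℝ] E} (h : ‖Q - P‖ < 1) {d : E} (hQ : Q d = d)
    (hP : P d = 0) : d = 0 := by
  by_contra hd
  have h1 : ‖d‖ ≤ ‖Q - P‖ * ‖d‖ := by
    simpa [hQ, hP] using (Q - P).le_opNorm d
  nlinarith [norm_pos_iff.2 hd]

variable {E : Type u} [NormedAddCommGroup E] [NormedSpace ℝ E] [FiniteDimensional ℝ E]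

/-- A smooth map on a neighbourhood of `e₀` coincides near `e₀` with a globally smooth map, obtained
by multiplication with a bump function. -/
theorem exists_contDiff_smul_eventuallyEq {F : Type*} [NormedAddCommGroup F] [NormedSpace ℝ F]
    {f : E → F} {V : Set E} (hV : IsOpen V) {e₀ : E} (he₀ : e₀ ∈ V) (hf : ContDiffOn ℝ ∞ f V) :
    ∃ ρ : E → ℝ, ContDiff ℝ ∞ (fun e => ρ e • f e) ∧ ρ =ᶠ[𝓝 e₀] 1 := by
  have : CompleteSpace E := FiniteDimensional.complete ℝ E
  obtain ⟨r, hr, hrV⟩ := Metric.nhds_basis_closedBall.mem_iff.1 (hV.mem_nhds he₀)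
  let ρ : ContDiffBump e₀ := ⟨r / 2, r, by positivity, by linarith⟩
  refine ⟨ρ, contDiff_iff_contDiffAt.2 fun e => ?_, ρ.eventuallyEq_one⟩
  by_cases he : e ∈ tsupport ρ
  · rw [ρ.tsupport_eq] at he
    exact ρ.contDiffAt.smul (hf.contDiffAt (hV.mem_nhds (hrV he)))
  · have : (fun e => ρ e • f e) =ᶠ[𝓝 e] fun _ => 0 := by
      filter_upwards [notMem_tsupport_iff_eventuallyEq.1 he] with x hx
      simp [hx]
    exact contDiffAt_const.congr_of_eventuallyEq this

/-- The graph parametrisation of the image of a projector field near a base point. -/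
theorem exists_frame_of_projector {Pr : E → E →L[ℝ] E} {U : Set E} (hU : IsOpen U) {e₀ : E}
    (he₀ : e₀ ∈ U) (hPr : ContDiffOn ℝ ∞ Pr U) (hproj : ∀ e ∈ U, Pr e * Pr e = Pr e) :
    ∃ (S : E → E →L[ℝ] E) (V : Set E), IsOpen V ∧ e₀ ∈ V ∧ V ⊆ U ∧ ContDiffOn ℝ ∞ S V ∧
      S e₀ = Pr e₀ ∧ (∀ e, S e * Pr e₀ = S e) ∧ ∀ e ∈ V, Pr e₀ * S e = Pr e₀ ∧
        Pr e * S e = S e ∧ S e * Pr e₀ * Pr e = Pr e ∧ ‖Pr e - Pr e₀‖ < 1 := by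
  have : CompleteSpace E := FiniteDimensional.complete ℝ E
  set P := Pr e₀ with hP
  have hPP : P * P = P := hproj e₀ he₀
  -- `Q e` is the compression of `Pr e` to `Im P`, completed by the identity on `Ker P`. It commutes
  -- with `P` and is invertible near `e₀`; inverting it normalises the frame so that `P * S e = P`.
  let Q : E → E →L[ℝ] E := fun e => P * Pr e * P + (1 - P)
  have hQs : ContDiffOn ℝ ∞ Q U :=
    ((contDiffOn_const.mul hPr).mul contDiffOn_const).add contDiffOn_const
  have hQ0 : Q e₀ = 1 := by
    simp only [Q, ← hP, hPP]
    abel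
  let S : E → E →L[ℝ] E := fun e => Pr e * Ring.inverse (Q e) * P
  let V : Set E := (U ∩ Q ⁻¹' {x | IsUnit x}) ∩ (U ∩ Pr ⁻¹' Metric.ball P 1)
  have hV : IsOpen V := (hQs.continuousOn.isOpen_inter_preimage hU Units.isOpen).inter
    (hPr.continuousOn.isOpen_inter_preimage hU Metric.isOpen_ball)
  refine ⟨S, V, hV, ⟨⟨he₀, ?_⟩, he₀, ?_⟩, fun e he => he.1.1, ?_, ?_, fun e => ?_, fun e he => ?_⟩
  · simp [hQ0]
  · simp [← hP]
  · intro e he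
    obtain ⟨A, hA⟩ := he.1.2
    have h1 : ContDiffAt ℝ ∞ Ring.inverse (Q e) := hA ▸ contDiffAt_ringInverse ℝ A
    have h2 : ContDiffAt ℝ ∞ Q e := hQs.contDiffAt (hU.mem_nhds he.1.1)
    have h3 : ContDiffAt ℝ ∞ Pr e := hPr.contDiffAt (hU.mem_nhds he.1.1)
    exact ((h3.mul (h1.comp e h2)).mul contDiffAt_const).contDiffWithinAt
  · simp [S, hQ0, ← hP, hPP]
  · simp only [S, mul_assoc, hPP]
  · have hR1 : Q e * Ring.inverse (Q e) = 1 := Ring.mul_inverse_cancel _ he.1.2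
    have hR2 : Ring.inverse (Q e) * Q e = 1 := Ring.inverse_mul_cancel _ he.1.2
    set R := Ring.inverse (Q e) with hR
    have hPQ : P * Q e = P * Pr e * P := by
      simp only [Q, mul_add, mul_sub, mul_one, ← mul_assoc, hPP, sub_self, add_zero]
    have hQP : Q e * P = P * Pr e * P := by
      simp only [Q, add_mul, sub_mul, one_mul, mul_assoc, hPP, sub_self, add_zero]
    have hcomm : R * P = P * R := by
      calc R * P = R * (P * Q e) * R := by rw [mul_assoc, mul_assoc, hR1, mul_one]
        _ = P * R := by rw [hPQ, ← hQP, ← mul_assoc, hR2, one_mul]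
    have hPrPr := hproj e he.1.1
    have hnorm : ‖Pr e - P‖ < 1 := by
      have := he.2.2
      rwa [mem_preimage, mem_ball_iff_norm] at this
    have h1 : P * S e = P := by
      change P * (Pr e * R * P) = P
      rw [mul_assoc, hcomm, ← mul_assoc, ← mul_assoc, ← hPQ, mul_assoc, hR1, mul_one]
    have h2 : Pr e * S e = S e := by
      simp only [S, ← mul_assoc, hPrPr]
    refine ⟨h1, h2, ?_, hnorm⟩
    ext w
    -- The difference is fixed by `Pr e` and killed by `P`.
    refine sub_eq_zero.1 (eq_zero_of_apply_eq_self_of_norm_sub_lt_one hnorm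
      (d := (S e * P * Pr e) w - Pr e w) ?_ ?_)
    · rw [← sub_apply, ← mul_apply_eq_comp, mul_sub, hPrPr, mul_assoc,
        ← mul_assoc (Pr e), h2]
    · rw [← sub_apply, ← mul_apply_eq_comp, mul_sub, ← mul_assoc, ← mul_assoc, h1, hPP,
        sub_self, zero_apply]

/-- **Frobenius theorem**, local form: a smooth field of projectors whose image is an involutive
distribution admits a chart which is flat for that distribution. -/
theorem exists_flat_chart_of_projector {Pr : E → E →L[ℝ] E} {U : Set E} (hU : IsOpen U) {e₀ : E}
    (he₀ : e₀ ∈ U) (hPr : ContDiffOn ℝ ∞ Pr U) (hproj : ∀ e ∈ U, Pr e * Pr e = Pr e)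
    (hint : ∀ e ∈ U, ∀ x y,
      fderiv ℝ Pr e (Pr e x) (Pr e y) = fderiv ℝ Pr e (Pr e y) (Pr e x)) :
    ∃ Ψ : OpenPartialHomeomorph E E, e₀ ∈ Ψ.source ∧ Ψ.source ⊆ U ∧ ContDiffOn ℝ ∞ Ψ Ψ.source ∧
      ContDiffOn ℝ ∞ Ψ.symm Ψ.target ∧ ∃ W : Submodule ℝ E, ∀ e ∈ Ψ.source, ∀ w,
        Pr e w = w ↔ fderiv ℝ Ψ e w ∈ W := by
  have : CompleteSpace E := FiniteDimensional.complete ℝ E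
  obtain ⟨S, V, hV, he₀V, hVU, hS, hS0, hSP, hSV⟩ := exists_frame_of_projector hU he₀ hPr hproj
  set P := Pr e₀ with hP
  have hPP : ∀ x, P (P x) = P x := fun x => DFunLike.congr_fun (hproj e₀ he₀) x
  -- The frame fields commute: their bracket is killed by `P`, because `P * S` is constant, and
  -- fixed by `Pr e`, by differentiating `Pr * S = S` and using involutivity.
  have hsymm : ∀ e ∈ V, ∀ x y, fderiv ℝ S e (S e x) y = fderiv ℝ S e (S e y) x := by
    intro e he x y
    have hdS : HasFDerivAt S (fderiv ℝ S e) e :=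
      ((hS.contDiffAt (hV.mem_nhds he)).differentiableAt (by simp)).hasFDerivAt
    have hdP : HasFDerivAt Pr (fderiv ℝ Pr e) e :=
      ((hPr.contDiffAt (hU.mem_nhds (hVU he))).differentiableAt (by simp)).hasFDerivAt
    have h1 : ∀ v z, fderiv ℝ Pr e v (S e z) + Pr e (fderiv ℝ S e v z) = fderiv ℝ S e v z := by
      intro v z
      have h := hdS.unique ((hdP.mul' hdS).congr_of_eventuallyEq
        (by filter_upwards [hV.mem_nhds he] with e' he' using (hSV e' he').2.1.symm))
      have h' := DFunLike.congr_fun (DFunLike.congr_fun h v) z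
      rw [add_comm]
      exact h'.symm
    have h2 : ∀ v z, P (fderiv ℝ S e v z) = 0 := by
      intro v z
      have h : HasFDerivAt (fun e' => P * S e') (0 : E →L[ℝ] E →L[ℝ] E) e :=
        (hasFDerivAt_const P e).congr_of_eventuallyEq
          (by filter_upwards [hV.mem_nhds he] with e' he' using (hSV e' he').1)
      have h' := (hdS.const_mul P).unique h
      exact DFunLike.congr_fun (DFunLike.congr_fun h' v) z
    have h3 : ∀ z, Pr e (S e z) = S e z := fun z => DFunLike.congr_fun (hSV e he).2.1 z
    refine sub_eq_zero.1 (eq_zero_of_apply_eq_self_of_norm_sub_lt_one (hSV e he).2.2.2 ?_ ?_)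
    · have hxy := hint e (hVU he) (S e x) (S e y)
      rw [h3, h3] at hxy
      rw [map_sub, eq_sub_of_add_eq' (h1 (S e x) y), eq_sub_of_add_eq' (h1 (S e y) x), hxy]
      abel
    · rw [map_sub, h2, h2, sub_zero]
  -- The superposition operator needs a frame defined and smooth on all of `E`, so `S` is cut off
  -- away from `e₀`.
  obtain ⟨ρ, hρ, hρ1⟩ := exists_contDiff_smul_eventuallyEq hV he₀V hS
  obtain ⟨V', hV', hV'o, he₀V'⟩ := eventually_nhds_iff.1 (hρ1.and (hV.mem_nhds he₀V))
  have hSρ : ∀ e ∈ V', ρ e • S e = S e := fun e he => by simp [(hV' e he).1]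
  let T : C(E, E →L[ℝ] E) := ⟨fun e => ρ e • S e, hρ.continuous⟩
  obtain ⟨Φ, hΦ, hΦe₀, hΦs, hΦs', hΦd⟩ := exists_straightening (S := T) hρ (P := P) (e₀ := e₀) hPP
    ((hSρ e₀ he₀V').trans hS0) (fun e x => by
      change ρ e • (S e * P) x = ρ e • S e x
      rw [hSP]) (by
      filter_upwards [hV'o.mem_nhds he₀V'] with e he x y
      have h1 : fderiv ℝ T e = fderiv ℝ S e := by
        refine Filter.EventuallyEq.fderiv_eq ?_
        filter_upwards [hV'o.mem_nhds he] with e' he' using hSρ e' he'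
      have h2 : T e = S e := hSρ e he
      rw [h1, h2]
      exact hsymm e (hV' e he).2 x y)
  -- `Φ` carries the constant distribution `Im P` to `Im (S e) = Im (Pr e)`, so its inverse is the
  -- flat chart and `W = Im P`.
  refine ⟨Φ.symm.restrOpen V' hV'o, ⟨?_, he₀V'⟩, fun e he => hVU (hV' e he.2).2,
    hΦs'.mono fun e he => he.1, hΦs.mono fun e he => ?_, P.range, fun e he w => ?_⟩
  · have := Φ.map_source hΦ
    rwa [hΦe₀] at this
  · exact he.1
  · have heT : e ∈ Φ.target := he.1
    have heV' : e ∈ V' := he.2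
    have hTe : T e = S e := hSρ e heV'
    obtain ⟨-, hPrS, hSPPr, -⟩ := hSV e (hV' e heV').2
    have hA : HasFDerivAt Φ (fderiv ℝ Φ (Φ.symm e)) (Φ.symm e) :=
      ((hΦs.contDiffAt (Φ.open_source.mem_nhds (Φ.map_target heT))).differentiableAt
        (by simp)).hasFDerivAt
    have hB : HasFDerivAt Φ.symm (fderiv ℝ Φ.symm e) e :=
      ((hΦs'.contDiffAt (Φ.open_target.mem_nhds heT)).differentiableAt (by simp)).hasFDerivAt
    have hAB : ∀ v, fderiv ℝ Φ (Φ.symm e) (fderiv ℝ Φ.symm e v) = v := by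
      intro v
      have h := (hA.comp e hB).unique ((hasFDerivAt_id e).congr_of_eventuallyEq
        (by filter_upwards [Φ.open_target.mem_nhds heT] with x hx using Φ.right_inv hx))
      exact DFunLike.congr_fun h v
    have hBA : ∀ v, fderiv ℝ Φ.symm e (fderiv ℝ Φ (Φ.symm e) v) = v := by
      intro v
      have hB' : HasFDerivAt Φ.symm (fderiv ℝ Φ.symm e) (Φ (Φ.symm e)) := by
        rwa [Φ.right_inv heT]
      have h := (hB'.comp (Φ.symm e) hA).unique ((hasFDerivAt_id (Φ.symm e)).congr_of_eventuallyEq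
        (by filter_upwards [Φ.open_source.mem_nhds (Φ.map_target heT)] with x hx
            using Φ.left_inv hx))
      exact DFunLike.congr_fun h v
    have hd : ∀ ξ, fderiv ℝ Φ (Φ.symm e) (P ξ) = S e ξ := by
      intro ξ
      rw [hΦd _ (Φ.map_target heT), Φ.right_inv heT, hTe]
    change _ ↔ fderiv ℝ Φ.symm e w ∈ P.range
    constructor
    · intro hw
      refine ⟨w, ?_⟩
      have h1 : S e (P w) = w := by
        have := DFunLike.congr_fun hSPPr w
        simpa [hw] using this
      have h2 := hd (P w)
      rw [hPP, h1] at h2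
      change P w = _
      conv_rhs => rw [← h2]
      exact (hBA _).symm
    · rintro ⟨ξ, hξ⟩
      have h1 : w = S e ξ := by
        rw [← hd, ← hAB w]
        exact congrArg _ hξ.symm
      rw [h1]
      exact DFunLike.congr_fun hPrS ξ

end Frobenius
end

/-! ### Vector fields and vector 1-forms in charts -/

noncomputable section
open Set Filter Topology VectorField

namespace LConn

theorem minSmoothness_two_le : minSmoothness ℝ 2 ≤ ∞ := by
  rw [minSmoothness_of_isRCLikeNormedField]
  exact WithTop.coe_le_coe.2 (le_top : (2 : ℕ∞) ≤ ⊤)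

theorem mlieBracket_eq_lieBracket {E : Type*} [NormedAddCommGroup E] [NormedSpace ℝ E]
    {V W : ∀ x : E, TangentSpace 𝓘(ℝ, E) x} (e : E) :
    mlieBracket 𝓘(ℝ, E) V W e = lieBracket ℝ (V : E → E) (W : E → E) e := by
  have h := congrFun (mlieBracketWithin_eq_lieBracketWithin (V := V) (W := W) (s := univ)) e
  rw [mlieBracketWithin_univ] at h
  exact h.trans (congrFun (lieBracketWithin_univ (𝕜 := ℝ) (V := V) (W := W)) e)

variable {E : Type*} [NormedAddCommGroup E] [NormedSpace ℝ E]
  {M : Type*} [TopologicalSpace M] [ChartedSpace E M]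

/-- The coordinate expression of a vector field in a chart. -/
def coordField (φ : OpenPartialHomeomorph M E) (X : VField E M) (e : E) : E :=
  mfderiv 𝓘(ℝ, E) 𝓘(ℝ, E) φ (φ.symm e) (X (φ.symm e))

/-- The coordinate expression of a vector `1`-form in a chart. -/
def coordForm (φ : OpenPartialHomeomorph M E) (K : VOneForm E M) (e : E) : E →L[ℝ] E :=
  (mfderiv 𝓘(ℝ, E) 𝓘(ℝ, E) φ (φ.symm e)).comp
    ((K (φ.symm e)).comp (mfderiv 𝓘(ℝ, E) 𝓘(ℝ, E) φ.symm e))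

variable [IsManifold 𝓘(ℝ, E) ∞ M] {φ : OpenPartialHomeomorph M E}

section chart

variable (hφ : φ ∈ IsManifold.maximalAtlas 𝓘(ℝ, E) ∞ M)
include hφ

omit [IsManifold 𝓘(ℝ, E) ∞ M] in
theorem mdifferentiable_of_mem_maximalAtlas : φ.MDifferentiable 𝓘(ℝ, E) 𝓘(ℝ, E) :=
  ⟨(contMDiffOn_of_mem_maximalAtlas hφ).mdifferentiableOn (by simp),
    (contMDiffOn_symm_of_mem_maximalAtlas hφ).mdifferentiableOn (by simp)⟩

omit [IsManifold 𝓘(ℝ, E) ∞ M] in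
theorem mfderiv_mfderiv_symm {e : E} (he : e ∈ φ.target) (v : E) :
    mfderiv 𝓘(ℝ, E) 𝓘(ℝ, E) φ (φ.symm e) (mfderiv 𝓘(ℝ, E) 𝓘(ℝ, E) φ.symm e v) = v :=
  DFunLike.congr_fun ((mdifferentiable_of_mem_maximalAtlas hφ).comp_symm_deriv he) v

omit [IsManifold 𝓘(ℝ, E) ∞ M] in
theorem mfderiv_symm_mfderiv {e : E} (he : e ∈ φ.target)
    (ξ : TangentSpace 𝓘(ℝ, E) (φ.symm e)) :
    mfderiv 𝓘(ℝ, E) 𝓘(ℝ, E) φ.symm e (mfderiv 𝓘(ℝ, E) 𝓘(ℝ, E) φ (φ.symm e) ξ) = ξ := by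
  have h := (mdifferentiable_of_mem_maximalAtlas hφ).symm_comp_deriv (φ.map_target he)
  have h' := DFunLike.congr_fun h ξ
  rw [φ.right_inv he] at h'
  exact h'


omit [IsManifold 𝓘(ℝ, E) ∞ M] in
theorem mfderiv_symm_inverse {e : E} (he : e ∈ φ.target) :
    (mfderiv 𝓘(ℝ, E) 𝓘(ℝ, E) φ.symm e).inverse = mfderiv 𝓘(ℝ, E) 𝓘(ℝ, E) φ (φ.symm e) :=
  ContinuousLinearMap.inverse_eq
    (ContinuousLinearMap.ext fun ξ => mfderiv_symm_mfderiv hφ he ξ)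
    (ContinuousLinearMap.ext fun v => mfderiv_mfderiv_symm hφ he v)

omit [IsManifold 𝓘(ℝ, E) ∞ M] in
theorem isInvertible_mfderiv_symm {e : E} (he : e ∈ φ.target) :
    (mfderiv 𝓘(ℝ, E) 𝓘(ℝ, E) φ.symm e).IsInvertible :=
  ⟨(mdifferentiable_of_mem_maximalAtlas hφ).symm.mfderiv he, rfl⟩

omit [IsManifold 𝓘(ℝ, E) ∞ M] in
theorem coordField_eqOn_mpullback (X : VField E M) :
    EqOn (coordField φ X) (mpullback 𝓘(ℝ, E) 𝓘(ℝ, E) φ.symm X) φ.target := by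
  intro e he
  rw [mpullback_apply, mfderiv_symm_inverse hφ he]
  rfl

omit [IsManifold 𝓘(ℝ, E) ∞ M] in
theorem coordField_app (K : VOneForm E M) (X : VField E M) {e : E} (he : e ∈ φ.target) :
    coordField φ (app K X) e = coordForm φ K e (coordField φ X e) :=
  congrArg (fun ξ => mfderiv 𝓘(ℝ, E) 𝓘(ℝ, E) φ (φ.symm e) (K (φ.symm e) ξ))
    (mfderiv_symm_mfderiv hφ he (X (φ.symm e))).symm

theorem contDiffAt_coordField [CompleteSpace E] {X : VField E M} {e : E} (he : e ∈ φ.target)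
    (hX : ContMDiffAt 𝓘(ℝ, E) 𝓘(ℝ, E).tangent ∞
      (fun x => (⟨x, X x⟩ : TangentBundle 𝓘(ℝ, E) M)) (φ.symm e)) :
    ContDiffAt ℝ ∞ (coordField φ X) e := by
  have : IsManifold 𝓘(ℝ, E) 1 M := .of_le (n := ∞) (by simp)
  have h := ContMDiffAt.mpullback_vectorField_preimage hX
    (contMDiffAt_symm_of_mem_maximalAtlas hφ he) (isInvertible_mfderiv_symm hφ he) (by simp)
  exact (contMDiffAt_vectorSpace_iff_contDiffAt.1 h).congr_of_eventuallyEq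
    ((coordField_eqOn_mpullback hφ X).eventuallyEq_of_mem (φ.open_target.mem_nhds he))

theorem coordField_lie [CompleteSpace E] {X Y : VField E M} (hX : SmoothField X)
    (hY : SmoothField Y) {e : E} (he : e ∈ φ.target) :
    coordField φ (lie X Y) e = lieBracket ℝ (coordField φ X) (coordField φ Y) e := by
  have : IsManifold 𝓘(ℝ, E) (minSmoothness ℝ 2) M := .of_le (n := ∞) minSmoothness_two_le
  have h := mpullback_mlieBracket (x₀ := e) ((hX (φ.symm e)).mdifferentiableAt (by simp))
    ((hY (φ.symm e)).mdifferentiableAt (by simp)) (contMDiffAt_symm_of_mem_maximalAtlas hφ he)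
    minSmoothness_two_le
  rw [coordField_eqOn_mpullback hφ _ he]
  refine h.trans ?_
  refine (mlieBracket_eq_lieBracket e).trans ?_
  exact Filter.EventuallyEq.lieBracket_vectorField_eq (𝕜 := ℝ) (E := E)
    ((coordField_eqOn_mpullback hφ X).eventuallyEq_of_mem (φ.open_target.mem_nhds he)).symm
    ((coordField_eqOn_mpullback hφ Y).eventuallyEq_of_mem (φ.open_target.mem_nhds he)).symm

end chart

/-- The vector field with constant components `v` in the chart `φ`. -/
def constField (φ : OpenPartialHomeomorph M E) (v : E) : VField E M := fun z =>
  mfderiv 𝓘(ℝ, E) 𝓘(ℝ, E) φ.symm (φ z) v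

/-- A vector `1`-form which maps smooth (local) vector fields to smooth vector fields. -/
def PreservesSmooth (K : VOneForm E M) : Prop :=
  ∀ (X : VField E M) (z : M), ContMDiffAt 𝓘(ℝ, E) 𝓘(ℝ, E).tangent ∞
      (fun x => (⟨x, X x⟩ : TangentBundle 𝓘(ℝ, E) M)) z →
    ContMDiffAt 𝓘(ℝ, E) 𝓘(ℝ, E).tangent ∞
      (fun x => (⟨x, app K X x⟩ : TangentBundle 𝓘(ℝ, E) M)) z

theorem SmoothForm.preservesSmooth {K : VOneForm E M} (hK : SmoothForm K) : PreservesSmooth K :=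
  fun _ z hX => ContMDiffAt.clm_bundle_apply (hK z) hX

/-- Smoothness of a form is used only through its action on fields. In this form it passes to `h`
without any work in the bundle `End(TM)`. -/
theorem PreservesSmooth.hproj {Γ : VOneForm E M} (hΓ : PreservesSmooth Γ) :
    PreservesSmooth (hproj Γ) := fun X z hX =>
  contMDiffAt_const.smul_section (hX.add_section (hΓ X z hX))

theorem PreservesSmooth.smoothField {K : VOneForm E M} (hK : PreservesSmooth K) {X : VField E M}
    (hX : SmoothField X) : SmoothField (app K X) := fun z => hK X z (hX z)

section chart

variable (hφ : φ ∈ IsManifold.maximalAtlas 𝓘(ℝ, E) ∞ M)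
include hφ

theorem contMDiffAt_constField [CompleteSpace E] (v : E) {z : M} (hz : z ∈ φ.source) :
    ContMDiffAt 𝓘(ℝ, E) 𝓘(ℝ, E).tangent ∞
      (fun x => (⟨x, constField φ v x⟩ : TangentBundle 𝓘(ℝ, E) M)) z := by
  have : IsManifold 𝓘(ℝ, E) 1 M := .of_le (n := ∞) (by simp)
  have hinv : ∀ x ∈ φ.source, (mfderiv 𝓘(ℝ, E) 𝓘(ℝ, E) φ x).IsInvertible := fun x hx =>
    ⟨(mdifferentiable_of_mem_maximalAtlas hφ).mfderiv hx, rfl⟩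
  have h := ContMDiffAt.mpullback_vectorField_preimage
    (V := fun x : E => (v : TangentSpace 𝓘(ℝ, E) x))
    (contMDiffAt_vectorSpace_iff_contDiffAt.2 contDiffAt_const)
    (contMDiffAt_of_mem_maximalAtlas hφ hz) (hinv z hz) (m := ∞) (by simp)
  refine h.congr_of_eventuallyEq ?_
  filter_upwards [φ.open_source.mem_nhds hz] with x hx
  have h1 : (mfderiv 𝓘(ℝ, E) 𝓘(ℝ, E) φ x).inverse = mfderiv 𝓘(ℝ, E) 𝓘(ℝ, E) φ.symm (φ x) :=
    ContinuousLinearMap.inverse_eq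
      (by
        have h := (mdifferentiable_of_mem_maximalAtlas hφ).comp_symm_deriv (φ.map_source hx)
        rwa [φ.left_inv hx] at h)
      ((mdifferentiable_of_mem_maximalAtlas hφ).symm_comp_deriv hx)
  exact congrArg (fun A : E →L[ℝ] TangentSpace 𝓘(ℝ, E) x => (⟨x, A v⟩ : TangentBundle 𝓘(ℝ, E) M))
    h1.symm

/-- In finite dimension, smoothness of an operator-valued map can be tested on fixed vectors `v`,
which are the coordinates of the fields `constField φ v`. -/
theorem contDiffOn_coordForm [FiniteDimensional ℝ E] {K : VOneForm E M}
    (hK : PreservesSmooth K) : ContDiffOn ℝ ∞ (coordForm φ K) φ.target := by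
  have : CompleteSpace E := FiniteDimensional.complete ℝ E
  refine contDiffOn_clm_apply.2 fun v e he => ContDiffAt.contDiffWithinAt ?_
  refine (contDiffAt_coordField hφ he (hK _ _
    (contMDiffAt_constField hφ v (φ.map_target he)))).congr_of_eventuallyEq ?_
  filter_upwards [φ.open_target.mem_nhds he] with x hx
  rw [coordField_app hφ _ _ hx]
  congr 1
  change v = mfderiv 𝓘(ℝ, E) 𝓘(ℝ, E) φ (φ.symm x)
    (mfderiv 𝓘(ℝ, E) 𝓘(ℝ, E) φ.symm (φ (φ.symm x)) v)
  rw [φ.right_inv hx]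
  exact (mfderiv_mfderiv_symm hφ hx v).symm

end chart

/-- Every tangent vector is the value of a global smooth vector field. -/
theorem exists_smoothField_eq [FiniteDimensional ℝ E] [T2Space M] (z : M)
    (ξ : TangentSpace 𝓘(ℝ, E) z) : ∃ X : VField E M, SmoothField X ∧ X z = ξ := by
  have : CompleteSpace E := FiniteDimensional.complete ℝ E
  have hφ : chartAt E z ∈ IsManifold.maximalAtlas 𝓘(ℝ, E) ∞ M :=
    IsManifold.chart_mem_maximalAtlas z
  obtain ⟨ρ⟩ : Nonempty (SmoothBumpFunction 𝓘(ℝ, E) z) := inferInstance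
  let v : E := mfderiv 𝓘(ℝ, E) 𝓘(ℝ, E) (chartAt E z) z ξ
  refine ⟨fun x => ρ x • constField (chartAt E z) v x, ?_, ?_⟩
  · exact ContMDiffOn.smul_section_of_tsupport ρ.contMDiff.contMDiffOn (chartAt E z).open_source
      ρ.tsupport_subset_chartAt_source
      fun x hx => (contMDiffAt_constField hφ v hx).contMDiffWithinAt
  · change ρ z • constField (chartAt E z) v z = ξ
    rw [ρ.eq_one, one_smul]
    exact DFunLike.congr_fun ((mdifferentiable_of_mem_maximalAtlas hφ).symm_comp_deriv
      (mem_chart_source E z)) ξ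

end LConn
end

/-! ### The Nijenhuis tensor in coordinates -/

noncomputable section
open Set Filter Topology VectorField

namespace LConn

section Model

variable {E : Type*} [NormedAddCommGroup E] [NormedSpace ℝ E]

/-- The Nijenhuis tensor of a field of endomorphisms of a vector space, in terms of its
derivative. -/
def nijenhuisAt (K : E → E →L[ℝ] E) (e x y : E) : E :=
  fderiv ℝ K e (K e x) y - fderiv ℝ K e (K e y) x + K e (fderiv ℝ K e y x) -
    K e (fderiv ℝ K e x y)

/-- The identity has zero derivative, and the terms in which it multiplies the derivative of `G`
cancel in pairs. What remains is quadratic in `G`, whence the factor `(1/2)²`. -/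
theorem nijenhuisAt_half_id_add {G P : E → E →L[ℝ] E} {e : E} (hG : DifferentiableAt ℝ G e)
    (hP : P =ᶠ[𝓝 e] fun e' => (1 / 2 : ℝ) • (ContinuousLinearMap.id ℝ E + G e')) (x y : E) :
    nijenhuisAt P e x y = (1 / 4 : ℝ) • nijenhuisAt G e x y := by
  have h : fderiv ℝ P e = (1 / 2 : ℝ) • fderiv ℝ G e :=
    (((hG.hasFDerivAt.const_add (ContinuousLinearMap.id ℝ E)).const_smul
      (1 / 2 : ℝ)).congr_of_eventuallyEq hP).fderiv
  rw [nijenhuisAt, nijenhuisAt, h, hP.eq_of_nhds]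
  simp only [smul_apply, add_apply, ContinuousLinearMap.id_apply, map_smul, map_add, smul_add]
  module

/-- Differentiate `P * P = P` and apply the result to a vector of `Im P`. -/
theorem apply_fderiv_apply_eq_zero {P : E → E →L[ℝ] E} {e : E} (hP : DifferentiableAt ℝ P e)
    (hPP : ∀ᶠ e' in 𝓝 e, P e' * P e' = P e') (v w : E) :
    P e (fderiv ℝ P e v (P e w)) = 0 := by
  have h := hP.hasFDerivAt.unique ((hP.hasFDerivAt.mul' hP.hasFDerivAt).congr_of_eventuallyEq
    (hPP.mono fun _ h => h.symm))
  have h1 : fderiv ℝ P e v (P e w) =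
      P e (fderiv ℝ P e v (P e w)) + fderiv ℝ P e v (P e (P e w)) :=
    DFunLike.congr_fun (DFunLike.congr_fun h v) (P e w)
  have h2 : P e (P e w) = P e w := DFunLike.congr_fun hPP.self_of_nhds w
  rw [h2] at h1
  exact right_eq_add.1 h1

/-- On a pair from `Im P` the two terms with an outer `P e` vanish. The remaining symmetry is
involutivity of `Im P`. -/
theorem fderiv_apply_comm_of_nijenhuisAt_eq_zero {P : E → E →L[ℝ] E} {e : E}
    (hP : DifferentiableAt ℝ P e) (hPP : ∀ᶠ e' in 𝓝 e, P e' * P e' = P e')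
    (h : ∀ x y, nijenhuisAt P e x y = 0) (x y : E) :
    fderiv ℝ P e (P e x) (P e y) = fderiv ℝ P e (P e y) (P e x) := by
  have h1 := h (P e x) (P e y)
  have h2 : ∀ w, P e (P e w) = P e w := DFunLike.congr_fun hPP.self_of_nhds
  rw [nijenhuisAt, h2, h2, apply_fderiv_apply_eq_zero hP hPP, apply_fderiv_apply_eq_zero hP hPP,
    add_zero, sub_zero] at h1
  exact sub_eq_zero.1 h1

/-- A field of projectors with constant image, whose kernel is the kernel of an integrable almost
tangent structure, has vanishing Nijenhuis tensor. -/
theorem nijenhuisAt_eq_zero_of_flat {P L : E → E →L[ℝ] E} {e : E}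
    (hP : DifferentiableAt ℝ P e) (hL : DifferentiableAt ℝ L e) {W : Submodule ℝ E}
    (hPW : ∀ᶠ e' in 𝓝 e, (∀ v, P e' v ∈ W) ∧ ∀ w ∈ W, P e' w = w)
    (hLP : ∀ᶠ e' in 𝓝 e, L e' * P e' = L e') (hLL : ∀ᶠ e' in 𝓝 e, L e' * L e' = 0)
    (hker : ∀ u, L e u = 0 → P e u = 0 ∧ ∃ a, L e a = u)
    (hN : ∀ x y, nijenhuisAt L e x y = 0) (x y : E) : nijenhuisAt P e x y = 0 := by
  have hP' := hP.hasFDerivAt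
  have hL' := hL.hasFDerivAt
  obtain ⟨hPmem, hPid⟩ := hPW.self_of_nhds
  have hmem : ∀ v x, fderiv ℝ P e v x ∈ W := by
    intro v x
    have h : HasFDerivAt (fun e' => P e * P e') (fderiv ℝ P e) e :=
      hP'.congr_of_eventuallyEq (hPW.mono fun e' he' =>
        ContinuousLinearMap.ext fun w => hPid _ (he'.1 w))
    have h1 : P e (fderiv ℝ P e v x) = fderiv ℝ P e v x :=
      DFunLike.congr_fun (DFunLike.congr_fun ((hP'.const_mul (P e)).unique h) v) x
    exact h1 ▸ hPmem _
  have hzero : ∀ v, ∀ w ∈ W, fderiv ℝ P e v w = 0 := by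
    intro v w hw
    have h1 : HasFDerivAt (fun e' => P e' w) ((fderiv ℝ P e).flip w) e := by
      simpa using hP'.clm_apply (hasFDerivAt_const w e)
    have h2 : HasFDerivAt (fun e' => P e' w) (0 : E →L[ℝ] E) e :=
      (hasFDerivAt_const w e).congr_of_eventuallyEq (hPW.mono fun e' he' => he'.2 w hw)
    exact DFunLike.congr_fun (h1.unique h2) v
  have hLP' : ∀ v u, L e (fderiv ℝ P e v u) + fderiv ℝ L e v (P e u) = fderiv ℝ L e v u := by
    intro v u
    exact DFunLike.congr_fun (DFunLike.congr_fun
      (((hL'.mul' hP').congr_of_eventuallyEq (hLP.mono fun _ h => h.symm)).unique hL') v) u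
  have hLL' : ∀ v u, L e (fderiv ℝ L e v u) + fderiv ℝ L e v (L e u) = 0 := by
    intro v u
    exact DFunLike.congr_fun (DFunLike.congr_fun ((hL'.mul' hL').unique
      ((hasFDerivAt_const (0 : E →L[ℝ] E) e).congr_of_eventuallyEq hLL)) v) u
  have hLPe : ∀ u, L e (P e u) = L e u := DFunLike.congr_fun hLP.self_of_nhds
  -- Write `v = L b` and expand the Nijenhuis tensor of `L` at `(u, b)`; the differentiated relation
  -- `L * L = 0` reduces it to this symmetry.
  have hsymm : ∀ u v, L e u = 0 → L e v = 0 → fderiv ℝ L e v u = fderiv ℝ L e u v := by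
    intro u v hu hv
    obtain ⟨b, rfl⟩ := (hker v hv).2
    have h1 := hN u b
    have h2 := hLL' b u
    rw [hu, map_zero, add_zero] at h2
    rw [nijenhuisAt, hu, map_zero, zero_apply, h2, eq_neg_of_add_eq_zero_left (hLL' u b)] at h1
    rw [← sub_eq_zero, ← neg_eq_zero, ← h1]
    abel
  -- The difference lies in `W`, where `P` is the identity. Differentiating `L * P = L` puts it in
  -- `Ker L`, where `P` is zero.
  have hd : ∀ u v, L e u = 0 → L e v = 0 → fderiv ℝ P e v u = fderiv ℝ P e u v := by
    intro u v hu hv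
    rw [← sub_eq_zero, ← hPid _ (W.sub_mem (hmem v u) (hmem u v))]
    refine (hker _ ?_).1
    have h1 := hLP' v u
    have h2 := hLP' u v
    rw [(hker u hu).1, map_zero, add_zero] at h1
    rw [(hker v hv).1, map_zero, add_zero] at h2
    rw [map_sub, h1, h2, hsymm u v hu hv, sub_self]
  have hres : ∀ x, L e (x - P e x) = 0 := fun x => by rw [map_sub, hLPe, sub_self]
  -- Derivatives of `P` kill `W`, so the symmetry for the vertical parts of `x` and `y` is, up to
  -- sign, the vanishing of the whole tensor.
  have h1 := hd (x - P e x) (y - P e y) (hres x) (hres y)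
  simp only [map_sub, sub_apply, hzero _ _ (hPmem _), sub_zero] at h1
  rw [nijenhuisAt, hPid _ (hmem _ _), hPid _ (hmem _ _), ← sub_eq_zero.2 h1]
  abel

end Model

variable {E : Type*} [NormedAddCommGroup E] [NormedSpace ℝ E]
  {M : Type*} [TopologicalSpace M] [ChartedSpace E M] [IsManifold 𝓘(ℝ, E) ∞ M]
  {φ : OpenPartialHomeomorph M E}

section chart

variable (hφ : φ ∈ IsManifold.maximalAtlas 𝓘(ℝ, E) ∞ M)
include hφ

/-- The derivatives of `X` and `Y` cancel, which is the tensoriality of the bracket. The factor `2`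
appears because both arguments are `K`. -/
theorem coordField_fnBracket_self [FiniteDimensional ℝ E] {K : VOneForm E M}
    (hK : PreservesSmooth K) {X Y : VField E M} (hX : SmoothField X) (hY : SmoothField Y) {e : E}
    (he : e ∈ φ.target) :
    coordField φ (fnBracket K K X Y) e =
      (2 : ℝ) • nijenhuisAt (coordForm φ K) e (coordField φ X e) (coordField φ Y e) := by
  have : CompleteSpace E := FiniteDimensional.complete ℝ E
  have hadd : ∀ A B : VField E M, coordField φ (A + B) e = coordField φ A e + coordField φ B e :=
    fun A B => map_add (mfderiv 𝓘(ℝ, E) 𝓘(ℝ, E) φ (φ.symm e)) _ _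
  have hsub : ∀ A B : VField E M, coordField φ (A - B) e = coordField φ A e - coordField φ B e :=
    fun A B => map_sub (mfderiv 𝓘(ℝ, E) 𝓘(ℝ, E) φ (φ.symm e)) _ _
  have hk : DifferentiableAt ℝ (coordForm φ K) e :=
    ((contDiffOn_coordForm hφ hK).contDiffAt (φ.open_target.mem_nhds he)).differentiableAt
      (by simp)
  have hd : ∀ Z : VField E M, SmoothField Z → ∀ v, fderiv ℝ (coordField φ (app K Z)) e v =
      coordForm φ K e (fderiv ℝ (coordField φ Z) e v) +
        fderiv ℝ (coordForm φ K) e v (coordField φ Z e) := by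
    intro Z hZ v
    have hz : DifferentiableAt ℝ (coordField φ Z) e :=
      (contDiffAt_coordField hφ he (hZ _)).differentiableAt (by simp)
    have h := (hk.hasFDerivAt.clm_apply hz.hasFDerivAt).congr_of_eventuallyEq
      (f₁ := coordField φ (app K Z)) (by
        filter_upwards [φ.open_target.mem_nhds he] with x hx using coordField_app hφ K Z hx)
    rw [h.fderiv]
    rfl
  have hKX := hK.smoothField hX
  have hKY := hK.smoothField hY
  simp only [fnBracket, hadd, hsub, coordField_app hφ _ _ he, coordField_lie hφ hKX hKY he,
    coordField_lie hφ hX hY he, coordField_lie hφ hKX hY he, coordField_lie hφ hX hKY he,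
    lieBracket, hd X hX, hd Y hY, map_add, map_sub, nijenhuisAt]
  module

omit [IsManifold 𝓘(ℝ, E) ∞ M] in
theorem eq_zero_of_coordField_eq_zero {B : VField E M} {e : E} (he : e ∈ φ.target)
    (h : coordField φ B e = 0) : B (φ.symm e) = 0 := by
  rw [← mfderiv_symm_mfderiv hφ he (B (φ.symm e))]
  exact (congrArg _ h).trans (map_zero _)

end chart

/-- By tensoriality, and because every tangent vector extends to a global smooth field, vanishing on
fields is a pointwise condition. It can then be used in any chart, flat ones included. -/
theorem vanishes_fnBracket_self_iff [FiniteDimensional ℝ E] [T2Space M] {K : VOneForm E M}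
    (hK : PreservesSmooth K) :
    Vanishes (fnBracket K K) ↔ ∀ φ ∈ IsManifold.maximalAtlas 𝓘(ℝ, E) ∞ M, ∀ e ∈ φ.target,
      ∀ x y, nijenhuisAt (coordForm φ K) e x y = 0 := by
  constructor
  · intro h φ hφ e he x y
    obtain ⟨X, hX, hXx⟩ := exists_smoothField_eq (φ.symm e)
      (mfderiv 𝓘(ℝ, E) 𝓘(ℝ, E) φ.symm e x)
    obtain ⟨Y, hY, hYy⟩ := exists_smoothField_eq (φ.symm e)
      (mfderiv 𝓘(ℝ, E) 𝓘(ℝ, E) φ.symm e y)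
    have hx : coordField φ X e = x := (congrArg _ hXx).trans (mfderiv_mfderiv_symm hφ he x)
    have hy : coordField φ Y e = y := (congrArg _ hYy).trans (mfderiv_mfderiv_symm hφ he y)
    have h1 := coordField_fnBracket_self hφ hK hX hY he
    rw [h X Y hX hY, hx, hy] at h1
    have h2 : coordField φ (0 : VField E M) e = 0 :=
      map_zero (mfderiv 𝓘(ℝ, E) 𝓘(ℝ, E) φ (φ.symm e))
    rw [h2] at h1
    exact (smul_eq_zero.1 h1.symm).resolve_left two_ne_zero
  · intro h X Y hX hY
    funext z
    have hφ : chartAt E z ∈ IsManifold.maximalAtlas 𝓘(ℝ, E) ∞ M :=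
      IsManifold.chart_mem_maximalAtlas z
    have he := mem_chart_target E z
    have h1 := eq_zero_of_coordField_eq_zero hφ he
      ((coordField_fnBracket_self hφ hK hX hY he).trans (by rw [h _ hφ _ he, smul_zero]))
    rw [(chartAt E z).left_inv (mem_chart_source E z)] at h1
    exact h1

end LConn
end

/-! ### The horizontal projector and the equivalences -/

noncomputable section
open Set Filter Topology VectorField

namespace LConn

section

variable {E : Type*} [NormedAddCommGroup E] [NormedSpace ℝ E]
  {M : Type*} [TopologicalSpace M] [ChartedSpace E M] {φ : OpenPartialHomeomorph M E}

theorem vanishes_smul_iff [IsManifold 𝓘(ℝ, E) ∞ M] {B : VTwoForm E M} {c : ℝ} (hc : c ≠ 0) :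
    Vanishes (fun X Y => c • B X Y) ↔ Vanishes B :=
  ⟨fun h X Y hX hY => (smul_eq_zero.1 (h X Y hX hY)).resolve_left hc,
    fun h X Y hX hY => by
      change c • B X Y = 0
      rw [h X Y hX hY, smul_zero]⟩

theorem coordForm_mul (hφ : φ ∈ IsManifold.maximalAtlas 𝓘(ℝ, E) ∞ M) {A B C : VOneForm E M}
    (h : ∀ z, (A z).comp (B z) = C z) {e : E} (he : e ∈ φ.target) :
    coordForm φ A e * coordForm φ B e = coordForm φ C e := by
  ext v
  change mfderiv 𝓘(ℝ, E) 𝓘(ℝ, E) φ (φ.symm e) (A (φ.symm e)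
    (mfderiv 𝓘(ℝ, E) 𝓘(ℝ, E) φ.symm e (mfderiv 𝓘(ℝ, E) 𝓘(ℝ, E) φ (φ.symm e)
      (B (φ.symm e) (mfderiv 𝓘(ℝ, E) 𝓘(ℝ, E) φ.symm e v))))) = _
  rw [mfderiv_symm_mfderiv hφ he]
  exact congrArg _ (DFunLike.congr_fun (h (φ.symm e)) _)

theorem coordForm_mfderiv (hφ : φ ∈ IsManifold.maximalAtlas 𝓘(ℝ, E) ∞ M) (K : VOneForm E M)
    {z : M} (hz : z ∈ φ.source) (ξ : TangentSpace 𝓘(ℝ, E) z) :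
    coordForm φ K (φ z) (mfderiv 𝓘(ℝ, E) 𝓘(ℝ, E) φ z ξ) =
      mfderiv 𝓘(ℝ, E) 𝓘(ℝ, E) φ z (K z ξ) := by
  -- The base point moves from `φ.symm (φ z)` to `z` with the vector read in the model space, so the
  -- substitution involves no dependent vector.
  have h1 : ∀ z', z' = z → ∀ v : E, (mfderiv 𝓘(ℝ, E) 𝓘(ℝ, E) φ z' (K z' v) : E) =
      mfderiv 𝓘(ℝ, E) 𝓘(ℝ, E) φ z (K z v) := by
    rintro _ rfl _
    rfl
  have h2 : (mfderiv 𝓘(ℝ, E) 𝓘(ℝ, E) φ.symm (φ z) (mfderiv 𝓘(ℝ, E) 𝓘(ℝ, E) φ z ξ) : E) = ξ :=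
    DFunLike.congr_fun ((mdifferentiable_of_mem_maximalAtlas hφ).symm_comp_deriv hz) ξ
  exact (h1 _ (φ.left_inv hz) _).trans (congrArg (fun v : E =>
    (mfderiv 𝓘(ℝ, E) 𝓘(ℝ, E) φ z (K z v) : E)) h2)

theorem coordForm_hproj (hφ : φ ∈ IsManifold.maximalAtlas 𝓘(ℝ, E) ∞ M) (Γ : VOneForm E M) {e : E}
    (he : e ∈ φ.target) :
    coordForm φ (hproj Γ) e =
      (1 / 2 : ℝ) • (ContinuousLinearMap.id ℝ E + coordForm φ Γ e) := by
  ext v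
  change mfderiv 𝓘(ℝ, E) 𝓘(ℝ, E) φ (φ.symm e) ((1 / 2 : ℝ) •
    (mfderiv 𝓘(ℝ, E) 𝓘(ℝ, E) φ.symm e v +
      Γ (φ.symm e) (mfderiv 𝓘(ℝ, E) 𝓘(ℝ, E) φ.symm e v))) = _
  rw [map_smul, map_add]
  exact congrArg (fun w : E => (1 / 2 : ℝ) • (w + coordForm φ Γ e v))
    (mfderiv_mfderiv_symm hφ he v)

section LConnection

variable [IsManifold 𝓘(ℝ, E) ∞ M] {L Γ : VOneForm E M}

theorem IsLConnection.comp_hproj (hΓ : IsLConnection L Γ) (z : M) :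
    (L z).comp (hproj Γ z) = L z := by
  ext ξ
  have h : L z (Γ z ξ) = L z ξ := DFunLike.congr_fun (hΓ.comp_left z) ξ
  change L z ((1 / 2 : ℝ) • (ξ + Γ z ξ)) = L z ξ
  rw [map_smul, map_add, h]
  module

theorem IsLConnection.hproj_comp (hΓ : IsLConnection L Γ) (z : M) :
    (hproj Γ z).comp (L z) = 0 := by
  ext ξ
  have h : Γ z (L z ξ) = -L z ξ := DFunLike.congr_fun (hΓ.comp_right z) ξ
  change (1 / 2 : ℝ) • (L z ξ + Γ z (L z ξ)) = 0
  rw [h, add_neg_cancel, smul_zero]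

/-- From `L h = L`, the vector `h ξ - ξ` lies in `Ker L = Im L`, which `h` kills. -/
theorem IsLConnection.hproj_comp_hproj {n : ℕ} (hL : IsTangentStructure n L)
    (hΓ : IsLConnection L Γ) (z : M) : (hproj Γ z).comp (hproj Γ z) = hproj Γ z := by
  ext ξ
  have h1 : hproj Γ z ξ - ξ ∈ (L z).ker := by
    change L z (hproj Γ z ξ - ξ) = 0
    rw [map_sub, sub_eq_zero]
    exact DFunLike.congr_fun (hΓ.comp_hproj z) ξ
  rw [← hL.range_eq_ker z] at h1
  obtain ⟨η, hη⟩ := h1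
  have h2 : hproj Γ z (L z η) = 0 := DFunLike.congr_fun (hΓ.hproj_comp z) η
  have h3 : hproj Γ z (hproj Γ z ξ - ξ) = 0 := hη ▸ h2
  rw [map_sub, sub_eq_zero] at h3
  exact h3

theorem mem_horizontal_iff {n : ℕ} (hL : IsTangentStructure n L) (hΓ : IsLConnection L Γ) (z : M)
    (ξ : TangentSpace 𝓘(ℝ, E) z) : ξ ∈ horizontal Γ z ↔ hproj Γ z ξ = ξ :=
  ⟨fun ⟨η, hη⟩ => by
    rw [← hη]
    exact DFunLike.congr_fun (IsLConnection.hproj_comp_hproj hL hΓ z) η, fun h => ⟨ξ, h⟩⟩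

end LConnection

variable [IsManifold 𝓘(ℝ, E) ∞ M] {L Γ : VOneForm E M}

theorem vanishes_curvature_iff (Γ : VOneForm E M) :
    Vanishes (curvature Γ) ↔ Vanishes (fnBracket (hproj Γ) (hproj Γ)) := by
  have h := vanishes_smul_iff (B := fnBracket (hproj Γ) (hproj Γ)) (c := -(1 / 2 : ℝ))
    (by norm_num)
  simp only [neg_smul] at h
  exact h

theorem vanishes_nijenhuis_iff_vanishes_curvature [FiniteDimensional ℝ E] [T2Space M]
    (hΓ : PreservesSmooth Γ) : Vanishes (nijenhuis Γ) ↔ Vanishes (curvature Γ) := by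
  have h1 : Vanishes (nijenhuis Γ) ↔ Vanishes (fnBracket Γ Γ) := vanishes_smul_iff (by norm_num)
  rw [h1, vanishes_curvature_iff, vanishes_fnBracket_self_iff hΓ,
    vanishes_fnBracket_self_iff hΓ.hproj]
  refine forall₄_congr fun φ hφ e he => forall₂_congr fun x y => ?_
  rw [nijenhuisAt_half_id_add (G := coordForm φ Γ) (P := coordForm φ (hproj Γ))
    (((contDiffOn_coordForm hφ hΓ).contDiffAt (φ.open_target.mem_nhds he)).differentiableAt
      (by simp))
    (by filter_upwards [φ.open_target.mem_nhds he] with x hx using coordForm_hproj hφ Γ hx)]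
  simp

omit [IsManifold 𝓘(ℝ, E) ∞ M] in
theorem mem_maximalAtlas_trans (hφ : φ ∈ IsManifold.maximalAtlas 𝓘(ℝ, E) ∞ M)
    {Ψ : OpenPartialHomeomorph E E} (hΨ : ContDiffOn ℝ ∞ Ψ Ψ.source)
    (hΨ' : ContDiffOn ℝ ∞ Ψ.symm Ψ.target) :
    φ.trans Ψ ∈ IsManifold.maximalAtlas 𝓘(ℝ, E) ∞ M := by
  have hG : Ψ ∈ contDiffGroupoid ∞ 𝓘(ℝ, E) := by
    rw [contDiffGroupoid, mem_groupoid_of_pregroupoid]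
    simpa [contDiffPregroupoid] using And.intro hΨ hΨ'
  rw [IsManifold.mem_maximalAtlas_iff] at hφ ⊢
  intro e' he'
  obtain ⟨h1, h2⟩ := hφ e' he'
  constructor
  · rw [OpenPartialHomeomorph.trans_symm_eq_symm_trans_symm, OpenPartialHomeomorph.trans_assoc]
    exact StructureGroupoid.trans _ (StructureGroupoid.symm _ hG) h1
  · rw [← OpenPartialHomeomorph.trans_assoc]
    exact StructureGroupoid.trans _ h2 hG

theorem completelyIntegrable_of_nijenhuisAt_eq_zero [FiniteDimensional ℝ E] {n : ℕ}
    (hL : IsTangentStructure n L) (hΓ : IsLConnection L Γ)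
    (h : ∀ φ ∈ IsManifold.maximalAtlas 𝓘(ℝ, E) ∞ M, ∀ e ∈ φ.target,
      ∀ x y, nijenhuisAt (coordForm φ (hproj Γ)) e x y = 0) :
    CompletelyIntegrable (horizontal Γ) := by
  intro z
  set φ := chartAt E z
  have hφ : φ ∈ IsManifold.maximalAtlas 𝓘(ℝ, E) ∞ M :=
    IsManifold.chart_mem_maximalAtlas z
  have hs : ContDiffOn ℝ ∞ (coordForm φ (hproj Γ)) φ.target :=
    contDiffOn_coordForm hφ hΓ.smooth.preservesSmooth.hproj
  have hpp : ∀ e ∈ φ.target, coordForm φ (hproj Γ) e * coordForm φ (hproj Γ) e =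
      coordForm φ (hproj Γ) e := fun e he =>
    coordForm_mul hφ (IsLConnection.hproj_comp_hproj hL hΓ) he
  obtain ⟨Ψ, hzΨ, hΨφ, hΨ, hΨ', W, hW⟩ := Frobenius.exists_flat_chart_of_projector φ.open_target
    (mem_chart_target E z) hs hpp fun e he =>
      fderiv_apply_comm_of_nijenhuisAt_eq_zero
        ((hs.contDiffAt (φ.open_target.mem_nhds he)).differentiableAt (by simp))
        (by filter_upwards [φ.open_target.mem_nhds he] with x hx using hpp x hx) (h φ hφ e he)
  refine ⟨φ.trans Ψ, mem_maximalAtlas_trans hφ hΨ hΨ', ⟨mem_chart_source E z, hzΨ⟩, W, ?_⟩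
  rintro w ⟨hwφ, hwΨ⟩ ξ
  have hφw : MDifferentiableAt 𝓘(ℝ, E) 𝓘(ℝ, E) φ w :=
    (mdifferentiable_of_mem_maximalAtlas hφ).mdifferentiableAt hwφ
  have hΨw : DifferentiableAt ℝ Ψ (φ w) :=
    (hΨ.contDiffAt (Ψ.open_source.mem_nhds hwΨ)).differentiableAt (by simp)
  have hcomp : (mfderiv 𝓘(ℝ, E) 𝓘(ℝ, E) (φ.trans Ψ) w ξ : E) =
      fderiv ℝ Ψ (φ w) (mfderiv 𝓘(ℝ, E) 𝓘(ℝ, E) φ w ξ) := by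
    have h1 := mfderiv_comp w hΨw.mdifferentiableAt hφw
    rw [mfderiv_eq_fderiv] at h1
    exact DFunLike.congr_fun h1 ξ
  refine (mem_horizontal_iff hL hΓ w ξ).trans (Iff.trans ?_
    ((hW (φ w) hwΨ (mfderiv 𝓘(ℝ, E) 𝓘(ℝ, E) φ w ξ)).trans
      (iff_of_eq (congrArg (· ∈ W) hcomp.symm))))
  rw [coordForm_mfderiv hφ (hproj Γ) hwφ]
  exact ((mdifferentiable_of_mem_maximalAtlas hφ).mfderiv_injective hwφ).eq_iff.symm

theorem vanishes_fnBracket_hproj_of_completelyIntegrable [FiniteDimensional ℝ E] [T2Space M] {n : ℕ}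
    (hL : IsTangentStructure n L) (hΓ : IsLConnection L Γ)
    (h : CompletelyIntegrable (horizontal Γ)) :
    Vanishes (fnBracket (hproj Γ) (hproj Γ)) := by
  have hLs := hL.smooth.preservesSmooth
  have hPs := hΓ.smooth.preservesSmooth.hproj
  have hN : Vanishes (fnBracket L L) := (vanishes_smul_iff (by norm_num)).1 hL.nijenhuis_eq_zero
  rw [vanishes_fnBracket_self_iff hLs] at hN
  intro X Y hX hY
  funext z
  obtain ⟨φ, hφ, hz, W, hW⟩ := h z
  have he : φ z ∈ φ.target := φ.map_source hz
  suffices hs : nijenhuisAt (coordForm φ (hproj Γ)) (φ z) (coordField φ X (φ z))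
      (coordField φ Y (φ z)) = 0 by
    have h1 := eq_zero_of_coordField_eq_zero hφ he
      ((coordField_fnBracket_self hφ hPs hX hY he).trans (by rw [hs, smul_zero]))
    rw [φ.left_inv hz] at h1
    exact h1
  have hdiff : ∀ {K : VOneForm E M}, PreservesSmooth K → DifferentiableAt ℝ (coordForm φ K) (φ z) :=
    fun hK => ((contDiffOn_coordForm hφ hK).contDiffAt
      (φ.open_target.mem_nhds he)).differentiableAt (by simp)
  have hLL : ∀ z, (L z).comp (L z) = (0 : VOneForm E M) z := by
    intro z
    ext ξ
    have : L z ξ ∈ (L z).ker := hL.range_eq_ker z ▸ ⟨ξ, rfl⟩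
    exact this
  have hnear := φ.open_target.mem_nhds he
  refine nijenhuisAt_eq_zero_of_flat (L := coordForm φ L) (W := W) (hdiff hPs) (hdiff hLs) ?_ ?_ ?_
    ?_ (hN φ hφ _ he) _ _
  · filter_upwards [hnear] with e he
    constructor
    · intro v
      exact (hW _ (φ.map_target he) _).1 ⟨_, rfl⟩
    · intro w hw
      have h1 : mfderiv 𝓘(ℝ, E) 𝓘(ℝ, E) φ.symm e w ∈ horizontal Γ (φ.symm e) := by
        refine (hW _ (φ.map_target he) _).2 ?_
        rw [mfderiv_mfderiv_symm hφ he]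
        exact hw
      rw [mem_horizontal_iff hL hΓ] at h1
      exact (congrArg _ h1).trans (mfderiv_mfderiv_symm hφ he w)
  · filter_upwards [hnear] with e he using coordForm_mul hφ hΓ.comp_hproj he
  · filter_upwards [hnear] with e he
    rw [coordForm_mul hφ hLL he]
    ext v
    exact map_zero (mfderiv 𝓘(ℝ, E) 𝓘(ℝ, E) φ (φ.symm e))
  -- A vertical vector is in `Im L` because `Im L = Ker L`, and is then killed by `h` because `h L =
  -- 0`.
  · intro u hu
    have h1 : mfderiv 𝓘(ℝ, E) 𝓘(ℝ, E) φ.symm (φ z) u ∈ (L (φ.symm (φ z))).ker := by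
      have h2 := congrArg (mfderiv 𝓘(ℝ, E) 𝓘(ℝ, E) φ.symm (φ z)) hu
      exact (mfderiv_symm_mfderiv hφ he _).symm.trans (h2.trans (map_zero _))
    rw [← hL.range_eq_ker] at h1
    obtain ⟨ξ, hξ⟩ := h1
    have h3 : coordForm φ L (φ z) (mfderiv 𝓘(ℝ, E) 𝓘(ℝ, E) φ (φ.symm (φ z)) ξ) = u := by
      have h4 := congrArg (fun η => mfderiv 𝓘(ℝ, E) 𝓘(ℝ, E) φ (φ.symm (φ z))
        (L (φ.symm (φ z)) η)) (mfderiv_symm_mfderiv hφ he ξ)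
      exact h4.trans ((congrArg _ hξ).trans (mfderiv_mfderiv_symm hφ he u))
    refine ⟨?_, _, h3⟩
    rw [← h3]
    have h5 := DFunLike.congr_fun (coordForm_mul hφ (C := (0 : VOneForm E M)) hΓ.hproj_comp he)
      (mfderiv 𝓘(ℝ, E) 𝓘(ℝ, E) φ (φ.symm (φ z)) ξ)
    exact h5.trans (map_zero (mfderiv 𝓘(ℝ, E) 𝓘(ℝ, E) φ (φ.symm (φ z))))

end

end LConn

end
theorem theorem7
    {E : Type*} [NormedAddCommGroup E] [NormedSpace ℝ E] [FiniteDimensional ℝ E]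
    {M : Type*} [TopologicalSpace M] [ChartedSpace E M] [IsManifold 𝓘(ℝ, E) ∞ M]
    [T2Space M] [ParacompactSpace M]
    (n : ℕ) (hn : 1 ≤ n)
    (L : LConn.VOneForm E M) (hL : LConn.IsTangentStructure n L)
    (Γ : LConn.VOneForm E M) (hΓ : LConn.IsLConnection L Γ) :
    List.TFAE [
      LConn.CompletelyIntegrable (LConn.horizontal Γ),
      LConn.Vanishes (LConn.nijenhuis Γ),
      LConn.Vanishes (LConn.curvature Γ)] := by
  have hΓs := hΓ.smooth.preservesSmooth
  tfae_have 2 ↔ 3 := LConn.vanishes_nijenhuis_iff_vanishes_curvature hΓs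
  tfae_have 1 → 3 := fun h => (LConn.vanishes_curvature_iff Γ).2
    (LConn.vanishes_fnBracket_hproj_of_completelyIntegrable hL hΓ h)
  tfae_have 3 → 1 := fun h => LConn.completelyIntegrable_of_nijenhuisAt_eq_zero hL hΓ
    ((LConn.vanishes_fnBracket_self_iff hΓs.hproj).1 ((LConn.vanishes_curvature_iff Γ).1 h))
  tfae_finish
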